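/- Let $M$ be a smooth manifold without boundary (finite-dimensional, Hausdorff, second countable). **(a)** Let $J\subseteq\mathbb R$ be open, $g(t)$ ($t\in J$) a smooth family of Riemannian metrics on $M$, $X(t)$ a time-dependent smooth vector field, $\psi_t$ ($t\in J$) a smooth family of diffeomorphisms of $M$ generated by $X$, i.e. $\frac{\partial}{\partial t}\psi_t(x)=X(t)(\psi_t(x))$, and $\sigma:J\to\mathbb R$ differentiable. Then $\hat g(t)=\sigma(t)\,\psi_t^*(g(t))$ satisfies $$\frac{\partial \hat g}{\partial t}=\sigma'(t)\,\psi_t^*(g)+\sigma(t)\,\psi_t^*\Big(\frac{\partial g}{\partial t}\Big)+\sigma(t)\,\psi_t^*(\mathcal L_X g).$$ **(b)** For a Riemannian metric $g$ with curvature $R(X,Y)Z=\nabla_X\nabla_YZ-\nabla_Y\nabla_XZ-\nabla_{[X,Y]}Z$ and a $(1,1)$-tensor field $\phi$, the $*$-Ricci tensor is $\mathrm{Ric}^*(g,\phi)(X,Y)=\tfrac12\operatorname{trace}\big(Z\mapsto R(X,\phi Y)\phi Z\big)$. Let $(\phi,\xi,\eta,g_0)$ be a smooth almost contact metric structure on $M$,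 that is, $\phi^2=-\mathrm{id}+\eta\otimes\xi$, $\eta(\xi)=1$ and $g_0(\phi X,\phi Y)=g_0(X,Y)-\eta(X)\eta(Y)$. Let $Y$ be a smooth vector field and $\lambda\in\mathbb R$ with $$-2\,\mathrm{Ric}^*(g_0,\phi)=\mathcal L_Yg_0-2\lambda g_0 .$$ Put $\sigma(t)=1-2\lambda t$, let $J\ni 0$ be an open interval on which $\sigma>0$, and let $\psi_t$ ($t\in J$) be a smooth family of diffeomorphisms of $M$ generated by the time-dependent vector field $\frac1{\sigma(t)}Y$, with $\psi_0=\mathrm{id}$. Put $\bar g(t)=\sigma(t)\,\psi_t^*g_0$. Then $\bar g(0)=g_0$, for every $t\in J$ the tensors $\big(\psi_t^*\phi,\ \sigma(t)^{-1/2}\psi_t^*\xi,\ \sigma(t)^{1/2}\psi_t^*\eta,\ \bar g(t)\big)$ form a smooth almost contact metric structure, and with respect to these structures $\bar g$ solves the $*$-Ricci flow on $J$: $$\frac{\partial\bar g}{\partial t}=-2\,\mathrm{Ric}^*\big(\bar g(t),\psi_t^*\phi\big).$$ In particular, if every $\psi_t$ preserves $\phi$, then $\frac{\partial\bar g}{\partial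 t}=-2\,\mathrm{Ric}^*(\bar g(t),\phi)$ on $J$ with $\phi$ fixed. -/

import Mathlib

open scoped Manifold ContDiff
open Bundle

noncomputable section

namespace StarRicci

variable {E : Type*} [NormedAddCommGroup E] [NormedSpace ℝ E]
  {M : Type*} [TopologicalSpace M] [ChartedSpace E M]

/-- Vector fields on the manifold `M` (not necessarily smooth). -/
abbrev VField (E : Type*) [NormedAddCommGroup E] [NormedSpace ℝ E]
    (M : Type*) [TopologicalSpace M] [ChartedSpace E M] :=
  (x : M) → TangentSpace 𝓘(ℝ, E) x

/-- Fields of real-valued functions of two tangent vectors at a point: covariant 2-tensor fields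
once they are bilinear. -/
abbrev CovTwo (E : Type*) [NormedAddCommGroup E] [NormedSpace ℝ E]
    (M : Type*) [TopologicalSpace M] [ChartedSpace E M] :=
  (x : M) → TangentSpace 𝓘(ℝ, E) x → TangentSpace 𝓘(ℝ, E) x → ℝ

/-- Fields of endomorphisms of the tangent spaces, i.e. `(1,1)`-tensor fields. -/
abbrev EndField (E : Type*) [NormedAddCommGroup E] [NormedSpace ℝ E]
    (M : Type*) [TopologicalSpace M] [ChartedSpace E M] :=
  (x : M) → TangentSpace 𝓘(ℝ, E) x →L[ℝ] TangentSpace 𝓘(ℝ, E) x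

/-- Fields of covectors, i.e. `1`-forms. -/
abbrev OneForm (E : Type*) [NormedAddCommGroup E] [NormedSpace ℝ E]
    (M : Type*) [TopologicalSpace M] [ChartedSpace E M] :=
  (x : M) → TangentSpace 𝓘(ℝ, E) x →L[ℝ] ℝ

/-- Smooth Riemannian metrics on `M`, in Mathlib's sense. -/
abbrev RMetric (E : Type*) [NormedAddCommGroup E] [NormedSpace ℝ E]
    (M : Type*) [TopologicalSpace M] [ChartedSpace E M] [IsManifold 𝓘(ℝ, E) ∞ M] :=
  ContMDiffRiemannianMetric 𝓘(ℝ, E) ∞ E (fun x : M => TangentSpace 𝓘(ℝ, E) x)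

variable [IsManifold 𝓘(ℝ, E) ∞ M]

/-- The vector field `X` is smooth. -/
def IsSmoothField (X : VField E M) : Prop :=
  ContMDiff 𝓘(ℝ, E) 𝓘(ℝ, E).tangent ∞ (fun x => (⟨x, X x⟩ : TangentBundle 𝓘(ℝ, E) M))

/-- The derivative `X f` of the function `f` along the vector field `X`. -/
def dirDeriv (X : VField E M) (f : M → ℝ) (x : M) : ℝ :=
  mfderiv 𝓘(ℝ, E) 𝓘(ℝ, ℝ) f x (X x)

/-- The Lie bracket of vector fields. -/
abbrev bracket (X Y : VField E M) : VField E M := VectorField.mlieBracket 𝓘(ℝ, E) X Y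

/-- The function `g(X, Y)`. -/
def pair (g : CovTwo E M) (X Y : VField E M) (x : M) : ℝ := g x (X x) (Y x)

/-! ### Lie derivative, Levi-Civita connection, curvature -/

open Classical in
/-- The Lie derivative `L_Y g`: at each point, the bilinear form determined by
`(L_Y g)(U, V) = Y(g(U, V)) - g([Y, U], V) - g(U, [Y, V])` for all smooth vector fields `U, V`
(the right-hand side is tensorial in `U` and `V` when `g` and `Y` are smooth). -/
def lieDeriv (Y : VField E M) (g : CovTwo E M) : CovTwo E M := fun x =>
  if h : ∃ B : TangentSpace 𝓘(ℝ, E) x →ₗ[ℝ] TangentSpace 𝓘(ℝ, E) x →ₗ[ℝ] ℝ,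
      ∀ U V : VField E M, IsSmoothField U → IsSmoothField V →
        B (U x) (V x) = dirDeriv Y (pair g U V) x
          - g x (bracket Y U x) (V x) - g x (U x) (bracket Y V x)
  then fun u v => h.choose u v
  else fun _ _ => 0

/-- The right-hand side of the Koszul formula, which equals `2 g(∇_X Y, Z)`. -/
def koszul (g : CovTwo E M) (X Y Z : VField E M) (x : M) : ℝ :=
  dirDeriv X (pair g Y Z) x + dirDeriv Y (pair g Z X) x - dirDeriv Z (pair g X Y) x
    + g x (bracket X Y x) (Z x) - g x (bracket Y Z x) (X x) + g x (bracket Z X x) (Y x)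

open Classical in
/-- The covariant derivative `∇_X Y` for the Levi-Civita connection of `g`: at each point, the
vector determined by the Koszul formula (for a Riemannian metric and smooth `X, Y` it exists and
is unique). -/
def leviCivita (g : CovTwo E M) (X Y : VField E M) : VField E M := fun x =>
  if h : ∃ v : TangentSpace 𝓘(ℝ, E) x, ∀ Z : VField E M, IsSmoothField Z →
      2 * g x v (Z x) = koszul g X Y Z x
  then h.choose
  else 0

/-- The field `R(X, Y)Z = ∇_X ∇_Y Z - ∇_Y ∇_X Z - ∇_{[X, Y]} Z`. -/
def curvatureField (g : CovTwo E M) (X Y Z : VField E M) : VField E M :=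
  leviCivita g X (leviCivita g Y Z) - leviCivita g Y (leviCivita g X Z)
    - leviCivita g (bracket X Y) Z

open Classical in
/-- The Riemann curvature tensor of `g` at `x`: the trilinear map whose value at
`X x, Y x, Z x` is `R(X, Y)Z` at `x`, for all smooth vector fields `X, Y, Z`. -/
def curvature (g : CovTwo E M) (x : M) :
    TangentSpace 𝓘(ℝ, E) x →ₗ[ℝ] TangentSpace 𝓘(ℝ, E) x →ₗ[ℝ]
      TangentSpace 𝓘(ℝ, E) x →ₗ[ℝ] TangentSpace 𝓘(ℝ, E) x :=
  if h : ∃ R : TangentSpace 𝓘(ℝ, E) x →ₗ[ℝ] TangentSpace 𝓘(ℝ, E) x →ₗ[ℝ]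
        TangentSpace 𝓘(ℝ, E) x →ₗ[ℝ] TangentSpace 𝓘(ℝ, E) x,
      ∀ X Y Z : VField E M, IsSmoothField X → IsSmoothField Y → IsSmoothField Z →
        R (X x) (Y x) (Z x) = curvatureField g X Y Z x
  then h.choose
  else 0

/-- The `*`-Ricci tensor of `(g, φ)`:
`Ric*(u, v) = (1/2) trace (z ↦ R(u, φ v) (φ z))`. -/
def starRicci (g : CovTwo E M) (φ : EndField E M) : CovTwo E M := fun x u v =>
  (1 / 2 : ℝ) * LinearMap.trace ℝ (TangentSpace 𝓘(ℝ, E) x)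
    (curvature g x u (φ x v) ∘ₗ (φ x : TangentSpace 𝓘(ℝ, E) x →ₗ[ℝ] TangentSpace 𝓘(ℝ, E) x))

/-! ### Almost contact metric structures and the `*`-Ricci flow -/

/-- The metric tensor of a Riemannian metric. -/
def RMetric.toCovTwo (G : RMetric E M) : CovTwo E M := fun x u v => G.inner x u v

/-- `g` is (the metric tensor of) a smooth Riemannian metric. -/
def IsRiemannian (g : CovTwo E M) : Prop := ∃ G : RMetric E M, RMetric.toCovTwo G = g

/-- `(φ, ξ, η, g)` is a smooth almost contact metric structure. (On a nonempty finite-dimensional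
manifold this forces the dimension to be odd.) -/
structure IsAlmostContactMetric (g : CovTwo E M) (φ : EndField E M) (ξ : VField E M)
    (η : OneForm E M) : Prop where
  riemannian : IsRiemannian g
  smooth_phi : ContMDiff 𝓘(ℝ, E) (𝓘(ℝ, E).prod 𝓘(ℝ, E →L[ℝ] E)) ∞
    (fun x => TotalSpace.mk' (E →L[ℝ] E)
      (E := fun x : M => TangentSpace 𝓘(ℝ, E) x →L[ℝ] TangentSpace 𝓘(ℝ, E) x) x (φ x))
  smooth_xi : IsSmoothField ξ
  smooth_eta : ContMDiff 𝓘(ℝ, E) (𝓘(ℝ, E).prod 𝓘(ℝ, E →L[ℝ] ℝ)) ∞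
    (fun x => TotalSpace.mk' (E →L[ℝ] ℝ)
      (E := fun x : M => TangentSpace 𝓘(ℝ, E) x →L[ℝ] ℝ) x (η x))
  phi_phi : ∀ x u, φ x (φ x u) = -u + η x u • ξ x
  eta_xi : ∀ x, η x (ξ x) = 1
  compat : ∀ x u v, g x (φ x u) (φ x v) = g x u v - η x u * η x v

/-- The `*`-Ricci flow equation `∂g/∂t = -2 Ric*(g)` for `t ∈ J`, where `Ric*(g(t))` is formed
with the structure tensor `φ(t)`. -/
def StarRicciFlowEq (J : Set ℝ) (g : ℝ → CovTwo E M) (φ : ℝ → EndField E M) : Prop :=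
  ∀ t ∈ J, ∀ (x : M) (u v : TangentSpace 𝓘(ℝ, E) x),
    HasDerivAt (fun s => g s x u v) (-2 * starRicci (g t) (φ t) x u v) t

/-- The almost contact metric structures `(φ(t), ξ(t), η(t), g(t))`, `t ∈ J`, form a solution of
the `*`-Ricci flow. -/
def IsStarRicciFlow (J : Set ℝ) (g : ℝ → CovTwo E M) (φ : ℝ → EndField E M)
    (ξ : ℝ → VField E M) (η : ℝ → OneForm E M) : Prop :=
  (∀ t ∈ J, IsAlmostContactMetric (g t) (φ t) (ξ t) (η t)) ∧ StarRicciFlowEq J g φ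

/-- `-2 Ric*(g) = L_Y g - 2 λ g`. -/
def IsStarRicciSoliton (g : CovTwo E M) (φ : EndField E M) (Y : VField E M) (lam : ℝ) : Prop :=
  ∀ (x : M) (u v : TangentSpace 𝓘(ℝ, E) x),
    -2 * starRicci g φ x u v = lieDeriv Y g x u v - 2 * lam * g x u v

/-- `g(t)`, `t ∈ J`, depends smoothly on time and space jointly. -/
def IsSmoothMetricFamily (J : Set ℝ) (g : ℝ → RMetric E M) : Prop :=
  ContMDiffOn (𝓘(ℝ, ℝ).prod 𝓘(ℝ, E)) (𝓘(ℝ, E).prod 𝓘(ℝ, E →L[ℝ] E →L[ℝ] ℝ)) ∞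
    (fun p : ℝ × M => TotalSpace.mk' (E →L[ℝ] E →L[ℝ] ℝ)
      (E := fun x : M => TangentSpace 𝓘(ℝ, E) x →L[ℝ] TangentSpace 𝓘(ℝ, E) x →L[ℝ] ℝ)
      p.2 ((g p.1).inner p.2))
    (J ×ˢ Set.univ)

/-! ### Families of diffeomorphisms and pullbacks -/

/-- The diffeomorphisms `ψ t`, `t ∈ J`, form a smooth family generated by the time-dependent
vector field `X`: `∂/∂t (ψ_t(x)) = X(t)(ψ_t(x))`. -/
structure IsGeneratedBy (J : Set ℝ) (ψ : ℝ → (M ≃ₘ⟮𝓘(ℝ, E), 𝓘(ℝ, E)⟯ M))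
    (X : ℝ → VField E M) : Prop where
  smooth : ContMDiffOn (𝓘(ℝ, ℝ).prod 𝓘(ℝ, E)) 𝓘(ℝ, E) ∞
    (fun p : ℝ × M => ψ p.1 p.2) (J ×ˢ Set.univ)
  velocity : ∀ t ∈ J, ∀ x : M,
    HasMFDerivAt 𝓘(ℝ, ℝ) 𝓘(ℝ, E) (fun s => ψ s x) t
      ((1 : ℝ →L[ℝ] ℝ).smulRight (X t (ψ t x)))

/-- The pullback `ψ^* B`. -/
def pullTwo (ψ : M ≃ₘ⟮𝓘(ℝ, E), 𝓘(ℝ, E)⟯ M) (B : CovTwo E M) : CovTwo E M := fun x u v =>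
  B (ψ x) (mfderiv 𝓘(ℝ, E) 𝓘(ℝ, E) ψ x u) (mfderiv 𝓘(ℝ, E) 𝓘(ℝ, E) ψ x v)

/-- The pullback `ψ^* φ = (dψ)⁻¹ ∘ φ ∘ dψ`. -/
def pullEnd (ψ : M ≃ₘ⟮𝓘(ℝ, E), 𝓘(ℝ, E)⟯ M) (φ : EndField E M) : EndField E M := fun x =>
  (mfderiv 𝓘(ℝ, E) 𝓘(ℝ, E) ψ x).inverse ∘L φ (ψ x) ∘L mfderiv 𝓘(ℝ, E) 𝓘(ℝ, E) ψ x

/-- The pullback `ψ^* ξ = (dψ)⁻¹ (ξ ∘ ψ)`. -/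
def pullField (ψ : M ≃ₘ⟮𝓘(ℝ, E), 𝓘(ℝ, E)⟯ M) (ξ : VField E M) : VField E M :=
  VectorField.mpullback 𝓘(ℝ, E) 𝓘(ℝ, E) ψ ξ

/-- The pullback `ψ^* η = η ∘ dψ`. -/
def pullForm (ψ : M ≃ₘ⟮𝓘(ℝ, E), 𝓘(ℝ, E)⟯ M) (η : OneForm E M) : OneForm E M := fun x =>
  η (ψ x) ∘L mfderiv 𝓘(ℝ, E) 𝓘(ℝ, E) ψ x

/-- The time derivative `∂g/∂t` of a family of covariant 2-tensor fields. -/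
def timeDeriv (g : ℝ → CovTwo E M) (t : ℝ) : CovTwo E M := fun x u v =>
  deriv (fun s => g s x u v) t

end StarRicci

end

noncomputable section

set_option linter.unusedSectionVars false

open scoped Topology
open Set VectorField

namespace StarRicci

section

variable {E : Type*} [NormedAddCommGroup E] [NormedSpace ℝ E]
  {M : Type*} [TopologicalSpace M] [ChartedSpace E M] [IsManifold 𝓘(ℝ, E) ∞ M]
  {N : Type*} [TopologicalSpace N] [ChartedSpace E N] [IsManifold 𝓘(ℝ, E) ∞ N]

/-! ### Smooth vector fields -/

/-! The evolution formula is the product rule once `σ` is removed. In fixed charts at `x` and `ψ_t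
x` the family becomes a smooth map `F(s, y)`, and the pulled-back metric is `Q(s, F)(∂_u F, ∂_v F)`.
Its `s`-derivative is the time derivative of `Q`, plus the derivative of `Q` along `X`, plus two
terms containing `∂_s ∂_u F = ∂_u ∂_s F = DX(∂_u F)`, by symmetry of second derivatives. The last
three terms are the coordinate expression of `L_X g`. This is `hasDerivAt_pullback_model`, combined
with `chart_lieDeriv` in `hasDerivAt_pullTwo`.

For solitons, the decisive fact is that `Ric*` commutes with diffeomorphisms and does not change
when the metric is multiplied by a positive constant (`starRicci_pullMetric`). Both sides of the
Koszul formula scale by the same constant, so the connection, the curvature and the trace are merely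
transported. Hence `-2 Ric*(ḡ, ψ_t^*φ) = ψ_t^*(-2 Ric*(g₀, φ)) = ψ_t^*(L_Y g₀ - 2λ g₀)`. The
evolution formula gives the same value for `∂ḡ/∂t`, since `σ' = -2λ` and the factor `σ` cancels the
`1/σ` in the generating field.

The Lie derivative, connection and curvature are defined by choice with a default value. For the
first two, existence is proved from chart formulas (`exists_lieExpr`, `two_mul_inner_leviCivita`).
For the curvature, naturality is proved whether or not the defining trilinear map exists. -/

lemma IsSmoothField.mdifferentiableAt {X : VField E M} (hX : IsSmoothField X) (x : M) :
    MDiffAt (T% X) x :=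
  ContMDiff.mdifferentiableAt hX (by simp)

lemma IsSmoothField.const_smul {X : VField E M} (hX : IsSmoothField X) (c : ℝ) :
    IsSmoothField (c • X) :=
  ContMDiff.smul_section (f := fun _ => c) contMDiff_const hX

/-- Every tangent vector extends to a smooth vector field. -/
lemma exists_isSmoothField [FiniteDimensional ℝ E] [T2Space M] (x : M)
    (u : TangentSpace 𝓘(ℝ, E) x) : ∃ U : VField E M, IsSmoothField U ∧ U x = u := by
  obtain ⟨s, hs, hU⟩ := FiberBundle.exists_contMDiffOn_extend (k := ∞) 𝓘(ℝ, E) E u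
  obtain ⟨ρ, -, hρ⟩ := (SmoothBumpFunction.nhds_basis_tsupport (I := 𝓘(ℝ, E)) x).mem_iff.1
    (interior_mem_nhds.2 hs)
  refine ⟨fun y => ρ y • FiberBundle.extend E u y, ?_, by simp⟩
  exact ContMDiffOn.smul_section_of_tsupport (n := ∞) ρ.contMDiff.contMDiffOn isOpen_interior hρ
    (hU.mono interior_subset)

lemma IsSmoothField.pullField [FiniteDimensional ℝ E] {X : VField E M} (hX : IsSmoothField X)
    (ψ : M ≃ₘ⟮𝓘(ℝ, E), 𝓘(ℝ, E)⟯ M) : IsSmoothField (pullField ψ X) := by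
  have := FiniteDimensional.complete ℝ E
  refine ContMDiff.mpullback_vectorField (n := ∞) (m := ∞) hX ψ.contMDiff ?_ (by simp)
  intro x
  exact ⟨ψ.mfderivToContinuousLinearEquiv (by simp) x, rfl⟩

/-! ### Smooth pairings -/

/-- The base point is itself a map `b`, so that a metric can be evaluated along an inverse chart, a
diffeomorphism or a curve in time. -/
lemma contMDiffAt_inner {H : Type*} [TopologicalSpace H] {F : Type*} [NormedAddCommGroup F]
    [NormedSpace ℝ F] {I : ModelWithCorners ℝ F H} {P : Type*} [TopologicalSpace P]
    [ChartedSpace H P] {b : P → M}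
    {A : (p : P) → TangentSpace 𝓘(ℝ, E) (b p) →L[ℝ] TangentSpace 𝓘(ℝ, E) (b p) →L[ℝ] ℝ}
    {u v : (p : P) → TangentSpace 𝓘(ℝ, E) (b p)} {p : P} {n : ℕ∞ω}
    (hA : ContMDiffAt I (𝓘(ℝ, E).prod 𝓘(ℝ, E →L[ℝ] E →L[ℝ] ℝ)) n
      (fun p => TotalSpace.mk' (E →L[ℝ] E →L[ℝ] ℝ)
        (E := fun x : M => TangentSpace 𝓘(ℝ, E) x →L[ℝ] TangentSpace 𝓘(ℝ, E) x →L[ℝ] ℝ)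
        (b p) (A p)) p)
    (hu : ContMDiffAt I 𝓘(ℝ, E).tangent n (fun p => (⟨b p, u p⟩ : TangentBundle 𝓘(ℝ, E) M)) p)
    (hv : ContMDiffAt I 𝓘(ℝ, E).tangent n (fun p => (⟨b p, v p⟩ : TangentBundle 𝓘(ℝ, E) M)) p) :
    ContMDiffAt I 𝓘(ℝ, ℝ) n (fun p => A p (u p) (v p)) p := by
  have : ContMDiffAt I (𝓘(ℝ, E).prod 𝓘(ℝ)) n
      (fun p ↦ TotalSpace.mk' ℝ (E := Bundle.Trivial M ℝ) (b p) (A p (u p) (v p))) p :=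
    ContMDiffAt.clm_bundle_apply₂ (F₁ := E) (F₂ := E) hA hu hv
  simp only [contMDiffAt_totalSpace] at this
  exact this.2

lemma mdifferentiableAt_pair (G : RMetric E M) {X Y : VField E M} {x : M}
    (hX : MDiffAt (T% X) x) (hY : MDiffAt (T% Y) x) :
    MDifferentiableAt 𝓘(ℝ, E) 𝓘(ℝ, ℝ) (pair G.toCovTwo X Y) x := by
  have : MDifferentiableAt 𝓘(ℝ, E) (𝓘(ℝ, E).prod 𝓘(ℝ))
      (fun p ↦ TotalSpace.mk' ℝ (E := Bundle.Trivial M ℝ) p (G.inner p (X p) (Y p))) x :=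
    MDifferentiableAt.clm_bundle_apply₂ (F₁ := E) (F₂ := E)
      (G.contMDiff.mdifferentiableAt (by simp)) hX hY
  simp only [mdifferentiableAt_totalSpace] at this
  exact this.2

/-- In finite dimension a linear map is a finite tuple of its values on a basis, so smoothness can
be checked value by value. -/
lemma contMDiffAt_of_forall_apply {H : Type*} [TopologicalSpace H] {F : Type*}
    [NormedAddCommGroup F] [NormedSpace ℝ F] {I : ModelWithCorners ℝ F H} {P : Type*}
    [TopologicalSpace P] [ChartedSpace H P] [FiniteDimensional ℝ E] {F' : Type*}
    [NormedAddCommGroup F'] [NormedSpace ℝ F'] {A : P → E →L[ℝ] F'} {p : P} {n : ℕ∞ω}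
    (h : ∀ u, ContMDiffAt I 𝓘(ℝ, F') n (fun q => A q u) p) :
    ContMDiffAt I 𝓘(ℝ, E →L[ℝ] F') n A p := by
  let d := Module.finrank ℝ E
  have hd : d = Module.finrank ℝ (Fin d → ℝ) := (Module.finrank_fin_fun ℝ).symm
  let e₁ := ContinuousLinearEquiv.ofFinrankEq hd
  let e₂ := (e₁.arrowCongr (1 : F' ≃L[ℝ] F')).trans (ContinuousLinearEquiv.piRing (Fin d))
  have h2 : ContMDiffAt I 𝓘(ℝ, Fin d → F') n (fun q => e₂ (A q)) p :=
    contMDiffAt_pi_space.2 fun i => h _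
  have h3 := e₂.symm.contDiff.contMDiff.contMDiffAt.comp p h2
  refine h3.congr_of_eventuallyEq (.of_forall fun q => ?_)
  simp

/-! ### Naturality of the Koszul expression under local diffeomorphisms -/

/-- The tensor field `c f^* g`. -/
def scaledPullback (c : ℝ) (f : N → M) (g : CovTwo E M) : CovTwo E N := fun x u v =>
  c * g (f x) (mfderiv 𝓘(ℝ, E) 𝓘(ℝ, E) f x u) (mfderiv 𝓘(ℝ, E) 𝓘(ℝ, E) f x v)

/-- `f` is smooth at `x`, and its derivative is invertible near `x`. -/
structure IsLocalDiffeoNear (f : N → M) (x : N) : Prop where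
  contMDiffAt : ContMDiffAt 𝓘(ℝ, E) 𝓘(ℝ, E) ∞ f x
  isInvertible : ∀ᶠ y in 𝓝 x, (mfderiv 𝓘(ℝ, E) 𝓘(ℝ, E) f y).IsInvertible

lemma mfderiv_mpullback {f : N → M} {x : N}
    (h : (mfderiv 𝓘(ℝ, E) 𝓘(ℝ, E) f x).IsInvertible) (X : VField E M) :
    mfderiv 𝓘(ℝ, E) 𝓘(ℝ, E) f x (mpullback 𝓘(ℝ, E) 𝓘(ℝ, E) f X x) = X (f x) := by
  rw [mpullback_apply]
  exact h.self_apply_inverse _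

/-- Where `df` is invertible it undoes the pullback of fields, so the paired function is `c • (g(Y,
Z) ∘ f)` near `x`. The chain rule then applies. -/
lemma dirDeriv_pair_mpullback (G : RMetric E M) (c : ℝ) {f : N → M} {x : N}
    (hf : IsLocalDiffeoNear (E := E) f x) {X Y Z : VField E M}
    (hY : MDiffAt (T% Y) (f x)) (hZ : MDiffAt (T% Z) (f x)) :
    dirDeriv (mpullback 𝓘(ℝ, E) 𝓘(ℝ, E) f X) (pair (scaledPullback c f G.toCovTwo)
      (mpullback 𝓘(ℝ, E) 𝓘(ℝ, E) f Y) (mpullback 𝓘(ℝ, E) 𝓘(ℝ, E) f Z)) x =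
    c * dirDeriv X (pair G.toCovTwo Y Z) (f x) := by
  have h1 : pair (scaledPullback c f G.toCovTwo)
      (mpullback 𝓘(ℝ, E) 𝓘(ℝ, E) f Y) (mpullback 𝓘(ℝ, E) 𝓘(ℝ, E) f Z) =ᶠ[𝓝 x]
      (c • (pair G.toCovTwo Y Z ∘ f) : N → ℝ) := by
    filter_upwards [hf.isInvertible] with y hy
    simp [pair, scaledPullback, mfderiv_mpullback hy]
  have h2 := mdifferentiableAt_pair G hY hZ
  have h3 := hf.contMDiffAt.mdifferentiableAt (by simp)
  unfold dirDeriv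
  rw [h1.mfderiv_eq, const_smul_mfderiv (h2.comp x h3), mfderiv_comp x h2 h3]
  change c * _ = c * _
  congr 1
  change mfderiv 𝓘(ℝ, E) 𝓘(ℝ, ℝ) (pair G.toCovTwo Y Z) (f x)
    (mfderiv 𝓘(ℝ, E) 𝓘(ℝ, E) f x (mpullback 𝓘(ℝ, E) 𝓘(ℝ, E) f X x)) = _
  rw [mfderiv_mpullback hf.isInvertible.self_of_nhds]

lemma two_le_infty : (2 : ℕ∞ω) ≤ ∞ :=
  WithTop.coe_le_coe.2 (le_top : (2 : ℕ∞) ≤ ⊤)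

lemma mfderiv_bracket_mpullback [CompleteSpace E] {f : N → M} {x : N}
    (hf : IsLocalDiffeoNear (E := E) f x) {X Y : VField E M}
    (hX : MDiffAt (T% X) (f x)) (hY : MDiffAt (T% Y) (f x)) :
    mfderiv 𝓘(ℝ, E) 𝓘(ℝ, E) f x (bracket (mpullback 𝓘(ℝ, E) 𝓘(ℝ, E) f X)
      (mpullback 𝓘(ℝ, E) 𝓘(ℝ, E) f Y) x) = bracket X Y (f x) := by
  have : IsManifold 𝓘(ℝ, E) (minSmoothness ℝ 2) M :=
    IsManifold.of_le (n := ∞) (by simpa using two_le_infty)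
  have : IsManifold 𝓘(ℝ, E) (minSmoothness ℝ 2) N :=
    IsManifold.of_le (n := ∞) (by simpa using two_le_infty)
  rw [bracket, ← mpullback_mlieBracket hX hY hf.contMDiffAt
      (by simpa using two_le_infty),
    mfderiv_mpullback hf.isInvertible.self_of_nhds]

/-- Derivatives of pairings and brackets are each natural. The lemma serves both inverse charts (`c
= 1`) and scaled pullbacks by diffeomorphisms. -/
lemma koszul_mpullback [CompleteSpace E] (G : RMetric E M) (c : ℝ) {f : N → M} {x : N}
    (hf : IsLocalDiffeoNear (E := E) f x) {X Y Z : VField E M}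
    (hX : MDiffAt (T% X) (f x)) (hY : MDiffAt (T% Y) (f x)) (hZ : MDiffAt (T% Z) (f x)) :
    koszul (scaledPullback c f G.toCovTwo) (mpullback 𝓘(ℝ, E) 𝓘(ℝ, E) f X)
      (mpullback 𝓘(ℝ, E) 𝓘(ℝ, E) f Y) (mpullback 𝓘(ℝ, E) 𝓘(ℝ, E) f Z) x =
    c * koszul G.toCovTwo X Y Z (f x) := by
  have h := hf.isInvertible.self_of_nhds
  unfold koszul
  rw [dirDeriv_pair_mpullback G c hf hY hZ, dirDeriv_pair_mpullback G c hf hZ hX,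
    dirDeriv_pair_mpullback G c hf hX hY]
  unfold scaledPullback
  rw [mfderiv_bracket_mpullback hf hX hY, mfderiv_bracket_mpullback hf hY hZ,
    mfderiv_bracket_mpullback hf hZ hX, mfderiv_mpullback h, mfderiv_mpullback h,
    mfderiv_mpullback h]
  ring

/-- The expression `Y(g(U, V)) - g([Y, U], V) - g(U, [Y, V])` defining the Lie derivative. -/
def lieExpr (g : CovTwo E M) (Y U V : VField E M) (x : M) : ℝ :=
  dirDeriv Y (pair g U V) x - g x (bracket Y U x) (V x) - g x (U x) (bracket Y V x)

lemma lieExpr_mpullback [CompleteSpace E] (G : RMetric E M) (c : ℝ) {f : N → M} {x : N}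
    (hf : IsLocalDiffeoNear (E := E) f x) {X Y Z : VField E M}
    (hX : MDiffAt (T% X) (f x)) (hY : MDiffAt (T% Y) (f x)) (hZ : MDiffAt (T% Z) (f x)) :
    lieExpr (scaledPullback c f G.toCovTwo) (mpullback 𝓘(ℝ, E) 𝓘(ℝ, E) f X)
      (mpullback 𝓘(ℝ, E) 𝓘(ℝ, E) f Y) (mpullback 𝓘(ℝ, E) 𝓘(ℝ, E) f Z) x =
    c * lieExpr G.toCovTwo X Y Z (f x) := by
  have h := hf.isInvertible.self_of_nhds
  unfold lieExpr
  rw [dirDeriv_pair_mpullback G c hf hY hZ]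
  unfold scaledPullback
  rw [mfderiv_bracket_mpullback hf hX hY,
    mfderiv_bracket_mpullback hf hX hZ, mfderiv_mpullback h, mfderiv_mpullback h]
  ring

end

section

variable {E : Type*} [NormedAddCommGroup E] [NormedSpace ℝ E]

/-! ### Formulas in the model space -/

section Model

/-- A field of bilinear forms on the model space. -/
def modelTensor (g : E → E →L[ℝ] E →L[ℝ] ℝ) : CovTwo E E := fun y u v => g y u v

variable {g : E → E →L[ℝ] E →L[ℝ] ℝ} {X Y Z : E → E} {y : E}

lemma bracket_model (X Y : E → E) (y : E) :
    bracket (M := E) X Y y = fderiv ℝ Y y (X y) - fderiv ℝ X y (Y y) := by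
  have h (V W : VField E E) : mlieBracket 𝓘(ℝ, E) V W y = lieBracket ℝ V W y := by
    rw [← mlieBracketWithin_univ, mlieBracketWithin_eq_lieBracketWithin]
    exact congrFun (lieBracketWithin_univ (𝕜 := ℝ) (V := (V : E → E)) (W := (W : E → E))) y
  exact h X Y

lemma dirDeriv_pair_model (hg : DifferentiableAt ℝ g y) (hY : DifferentiableAt ℝ Y y)
    (hZ : DifferentiableAt ℝ Z y) :
    dirDeriv (M := E) X (pair (modelTensor g) Y Z) y =
      fderiv ℝ g y (X y) (Y y) (Z y) + g y (fderiv ℝ Y y (X y)) (Z y)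
        + g y (Y y) (fderiv ℝ Z y (X y)) := by
  have h : HasFDerivAt (fun z => g z (Y z) (Z z)) _ y :=
    (hg.hasFDerivAt.clm_apply hY.hasFDerivAt).clm_apply hZ.hasFDerivAt
  unfold dirDeriv
  rw [mfderiv_eq_fderiv]
  change fderiv ℝ (fun z => g z (Y z) (Z z)) y (X y) = _
  rw [h.fderiv]
  simp
  ring

/-- With `g` symmetric, the brackets cancel every first derivative of `X` and `Z` and double the one
of `Y`. What remains is linear in `Z y`, so it can be solved for `∇_X Y`. -/
lemma koszul_model (hsymm : ∀ u v, g y u v = g y v u) (hg : DifferentiableAt ℝ g y)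
    (hX : DifferentiableAt ℝ X y) (hY : DifferentiableAt ℝ Y y) (hZ : DifferentiableAt ℝ Z y) :
    koszul (M := E) (modelTensor g) X Y Z y =
      2 * g y (fderiv ℝ Y y (X y)) (Z y) + fderiv ℝ g y (X y) (Y y) (Z y)
        + fderiv ℝ g y (Y y) (Z y) (X y) - fderiv ℝ g y (Z y) (X y) (Y y) := by
  unfold koszul
  rw [dirDeriv_pair_model hg hY hZ, dirDeriv_pair_model hg hZ hX, dirDeriv_pair_model hg hX hY,
    bracket_model, bracket_model, bracket_model]
  simp only [modelTensor, map_sub, sub_apply]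
  rw [hsymm (Y y) (fderiv ℝ Z y (X y)), hsymm (Z y) (fderiv ℝ X y (Y y)),
    hsymm (X y) (fderiv ℝ Y y (Z y))]
  ring

/-- The derivatives of `Y` and `Z` cancel, which shows that the expression is tensorial in them. -/
lemma lieExpr_model (hg : DifferentiableAt ℝ g y)
    (hY : DifferentiableAt ℝ Y y) (hZ : DifferentiableAt ℝ Z y) :
    lieExpr (M := E) (modelTensor g) X Y Z y =
      fderiv ℝ g y (X y) (Y y) (Z y) + g y (fderiv ℝ X y (Y y)) (Z y)
        + g y (Y y) (fderiv ℝ X y (Z y)) := by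
  unfold lieExpr
  rw [dirDeriv_pair_model hg hY hZ, bracket_model, bracket_model]
  simp only [modelTensor, map_sub, sub_apply]
  ring

end Model

/-! ### Charts -/

section Chart

variable {M : Type*} [TopologicalSpace M] [ChartedSpace E M]

variable (E) in
/-- The derivative of the inverse of the chart at `p`. -/
def dchart (p : M) (y : E) : E →L[ℝ] E :=
  mfderiv 𝓘(ℝ, E) 𝓘(ℝ, E) (extChartAt 𝓘(ℝ, E) p).symm y

/-- A vector field in the chart at `p`. -/
def chartField (p : M) (X : VField E M) : E → E :=
  mpullback 𝓘(ℝ, E) 𝓘(ℝ, E) (extChartAt 𝓘(ℝ, E) p).symm X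

variable [IsManifold 𝓘(ℝ, E) ∞ M]

/-- A Riemannian metric in the chart at `p`. -/
def chartMetric (p : M) (G : RMetric E M) (y : E) : E →L[ℝ] E →L[ℝ] ℝ :=
  let A : E →L[ℝ] E →L[ℝ] ℝ := G.inner ((extChartAt 𝓘(ℝ, E) p).symm y)
  A.bilinearComp (dchart E p y) (dchart E p y)

lemma chartMetric_apply (p : M) (G : RMetric E M) (y u v : E) :
    chartMetric p G y u v =
      G.inner ((extChartAt 𝓘(ℝ, E) p).symm y) (dchart E p y u) (dchart E p y v) := rfl

/-- Writing the chart metric as a scaled pullback with factor `1` makes the naturality lemmas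
applicable to the inverse chart. -/
lemma modelTensor_chartMetric (p : M) (G : RMetric E M) :
    modelTensor (chartMetric p G) =
      scaledPullback 1 (extChartAt 𝓘(ℝ, E) p).symm G.toCovTwo := by
  funext y u v
  simp only [scaledPullback, one_mul]
  rfl

lemma contMDiffAt_extChartAt_symm (p : M) {y : E} (hy : y ∈ (extChartAt 𝓘(ℝ, E) p).target) :
    ContMDiffAt 𝓘(ℝ, E) 𝓘(ℝ, E) ∞ (extChartAt 𝓘(ℝ, E) p).symm y :=
  (contMDiffOn_extChartAt_symm p).contMDiffAt ((isOpen_extChartAt_target p).mem_nhds hy)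

lemma isInvertible_mfderiv_extChartAt_symm (p : M) {y : E}
    (hy : y ∈ (extChartAt 𝓘(ℝ, E) p).target) :
    (mfderiv 𝓘(ℝ, E) 𝓘(ℝ, E) (extChartAt 𝓘(ℝ, E) p).symm y).IsInvertible := by
  have := isInvertible_mfderivWithin_extChartAt_symm (I := 𝓘(ℝ, E)) (M := M) hy
  simpa only [ModelWithCorners.range_eq_univ, mfderivWithin_univ] using this

lemma isInvertible_dchart (p : M) {y : E} (hy : y ∈ (extChartAt 𝓘(ℝ, E) p).target) :
    (dchart E p y).IsInvertible :=
  isInvertible_mfderiv_extChartAt_symm p hy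

lemma isLocalDiffeoNear_extChartAt_symm (p : M) {y : E}
    (hy : y ∈ (extChartAt 𝓘(ℝ, E) p).target) :
    IsLocalDiffeoNear (E := E) (extChartAt 𝓘(ℝ, E) p).symm y where
  contMDiffAt := contMDiffAt_extChartAt_symm p hy
  isInvertible := by
    filter_upwards [(isOpen_extChartAt_target p).mem_nhds hy] with z hz
    exact isInvertible_mfderiv_extChartAt_symm p hz

lemma dchart_chartField (p : M) {y : E} (hy : y ∈ (extChartAt 𝓘(ℝ, E) p).target)
    (X : VField E M) :
    dchart E p y (chartField p X y) = X ((extChartAt 𝓘(ℝ, E) p).symm y) :=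
  mfderiv_mpullback (isInvertible_mfderiv_extChartAt_symm p hy) X

lemma contDiffAt_chartField [CompleteSpace E] (p : M) {y : E}
    (hy : y ∈ (extChartAt 𝓘(ℝ, E) p).target) {X : VField E M}
    (hX : ContMDiffAt 𝓘(ℝ, E) 𝓘(ℝ, E).tangent ∞
      (fun x => (⟨x, X x⟩ : TangentBundle 𝓘(ℝ, E) M)) ((extChartAt 𝓘(ℝ, E) p).symm y)) :
    ContDiffAt ℝ ∞ (chartField p X) y := by
  have h := ContMDiffAt.mpullback_vectorField_preimage (m := ∞) (n := ∞) hX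
    (contMDiffAt_extChartAt_symm p hy) (isInvertible_mfderiv_extChartAt_symm p hy) (by simp)
  exact contMDiffAt_vectorSpace_iff_contDiffAt.1 h

/-- The section is the tangent map of the inverse chart applied to the smooth section `u`. -/
lemma contMDiffAt_dchart (p : M) {y : E} (hy : y ∈ (extChartAt 𝓘(ℝ, E) p).target) {u : E → E}
    (hu : ContDiffAt ℝ ∞ u y) :
    ContMDiffAt 𝓘(ℝ, E) 𝓘(ℝ, E).tangent ∞
      (fun z => (⟨(extChartAt 𝓘(ℝ, E) p).symm z, dchart E p z (u z)⟩ :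
        TangentBundle 𝓘(ℝ, E) M)) y := by
  have hopen := (isOpen_extChartAt_target (I := 𝓘(ℝ, E)) p)
  have h1 := (contMDiffOn_extChartAt_symm (I := 𝓘(ℝ, E)) (n := ∞) p).contMDiffOn_tangentMapWithin
    (m := ∞) (by simp) hopen.uniqueMDiffOn
  have h2 : ContMDiffAt 𝓘(ℝ, E) 𝓘(ℝ, E).tangent ∞
      (fun z => (⟨z, u z⟩ : TangentBundle 𝓘(ℝ, E) E)) y :=
    contMDiffAt_vectorSpace_iff_contDiffAt.2 hu
  have h3 := (h1 ⟨y, u y⟩ hy).comp (s := (extChartAt 𝓘(ℝ, E) p).target) y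
    h2.contMDiffWithinAt (fun z hz => hz)
  refine (h3.contMDiffAt (hopen.mem_nhds hy)).congr_of_eventuallyEq ?_
  filter_upwards [hopen.mem_nhds hy] with z hz
  simp only [Function.comp, tangentMapWithin]
  rw [mfderivWithin_of_isOpen hopen hz]
  rfl

/-- Statements about a single metric are obtained from those about families through this constant
family. -/
lemma isSmoothMetricFamily_const (J : Set ℝ) (G : RMetric E M) :
    IsSmoothMetricFamily J (fun _ => G) :=
  (G.contMDiff.comp contMDiff_snd).contMDiffOn

lemma contDiffAt_chartMetric_family [FiniteDimensional ℝ E] {J : Set ℝ} (hJ : IsOpen J)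
    {g : ℝ → RMetric E M} (hg : IsSmoothMetricFamily J g) {t : ℝ} (ht : t ∈ J) (p : M) {y : E}
    (hy : y ∈ (extChartAt 𝓘(ℝ, E) p).target) :
    ContDiffAt ℝ ∞ (fun q : ℝ × E => chartMetric p (g q.1) q.2) (t, y) := by
  have key (u v : E) : ContDiffAt ℝ ∞ (fun q : ℝ × E => chartMetric p (g q.1) q.2 u v) (t, y) := by
    have hb : ContMDiffAt 𝓘(ℝ, ℝ × E) (𝓘(ℝ, ℝ).prod 𝓘(ℝ, E)) ∞
        (fun q : ℝ × E => (q.1, (extChartAt 𝓘(ℝ, E) p).symm q.2)) (t, y) :=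
      contDiff_fst.contMDiff.contMDiffAt.prodMk
        ((contMDiffAt_extChartAt_symm p hy).comp (t, y) contDiff_snd.contMDiff.contMDiffAt)
    have hA := ((hg (t, (extChartAt 𝓘(ℝ, E) p).symm y) ⟨ht, mem_univ _⟩).contMDiffAt
      ((hJ.prod isOpen_univ).mem_nhds ⟨ht, mem_univ _⟩)).comp (t, y) hb
    have hd (w : E) := (contMDiffAt_dchart p hy (contDiffAt_const (c := w))).comp (t, y)
      (contDiff_snd (𝕜 := ℝ) (E := ℝ) (F := E) (n := ∞)).contMDiff.contMDiffAt
    exact (contMDiffAt_inner hA (hd u) (hd v)).contDiffAt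
  exact (contMDiffAt_of_forall_apply fun u => contMDiffAt_of_forall_apply fun v =>
    (key u v).contMDiffAt).contDiffAt

lemma contDiffAt_chartMetric [FiniteDimensional ℝ E] (p : M) (G : RMetric E M) {y : E}
    (hy : y ∈ (extChartAt 𝓘(ℝ, E) p).target) : ContDiffAt ℝ ∞ (chartMetric p G) y := by
  have h := contDiffAt_chartMetric_family isOpen_univ (isSmoothMetricFamily_const univ G)
    (mem_univ (0 : ℝ)) p hy
  exact h.comp y (contDiffAt_const.prodMk contDiffAt_id)

end Chart

end

section

variable {E : Type*} [NormedAddCommGroup E] [NormedSpace ℝ E] [FiniteDimensional ℝ E]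
  {M : Type*} [TopologicalSpace M] [T2Space M] [ChartedSpace E M] [IsManifold 𝓘(ℝ, E) ∞ M]

/-! ### The Lie derivative of a metric -/

lemma chart_lieExpr (p : M) (G : RMetric E M) {y : E} (hy : y ∈ (extChartAt 𝓘(ℝ, E) p).target)
    {X U V : VField E M} (hX : IsSmoothField X) (hU : IsSmoothField U) (hV : IsSmoothField V) :
    lieExpr G.toCovTwo X U V ((extChartAt 𝓘(ℝ, E) p).symm y) =
      fderiv ℝ (chartMetric p G) y (chartField p X y) (chartField p U y) (chartField p V y)
        + chartMetric p G y (fderiv ℝ (chartField p X) y (chartField p U y)) (chartField p V y)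
        + chartMetric p G y (chartField p U y)
          (fderiv ℝ (chartField p X) y (chartField p V y)) := by
  have := FiniteDimensional.complete ℝ E
  have h := lieExpr_mpullback G 1 (isLocalDiffeoNear_extChartAt_symm p hy)
    (hX.mdifferentiableAt _) (hU.mdifferentiableAt _) (hV.mdifferentiableAt _)
  rw [one_mul, ← modelTensor_chartMetric] at h
  rw [← h]
  exact lieExpr_model ((contDiffAt_chartMetric p G hy).differentiableAt (by simp))
    ((contDiffAt_chartField p hy hU.contMDiffAt).differentiableAt (by simp))
    ((contDiffAt_chartField p hy hV.contMDiffAt).differentiableAt (by simp))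

lemma exists_lieExpr (G : RMetric E M) {X : VField E M} (hX : IsSmoothField X) (x : M) :
    ∃ B : TangentSpace 𝓘(ℝ, E) x →ₗ[ℝ] TangentSpace 𝓘(ℝ, E) x →ₗ[ℝ] ℝ,
      ∀ U V : VField E M, IsSmoothField U → IsSmoothField V →
        B (U x) (V x) = lieExpr G.toCovTwo X U V x := by
  -- The type of `B` depends on the base point. The claim is proved at points of the form `symm y`,
  -- and the whole existence statement is then rewritten to the point `x`.
  suffices h : ∀ y ∈ (extChartAt 𝓘(ℝ, E) x).target,
      ∃ B : E →ₗ[ℝ] E →ₗ[ℝ] ℝ, ∀ U V : VField E M, IsSmoothField U → IsSmoothField V →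
        B (U ((extChartAt 𝓘(ℝ, E) x).symm y)) (V ((extChartAt 𝓘(ℝ, E) x).symm y)) =
          lieExpr G.toCovTwo X U V ((extChartAt 𝓘(ℝ, E) x).symm y) by
    have h' := h _ (mem_extChartAt_target x)
    rw [extChartAt_to_inv] at h'
    exact h'
  intro y hy
  let D := (dchart E x y).inverse
  let T := fderiv ℝ (chartMetric x G) y (chartField x X y)
  let A := fderiv ℝ (chartField x X) y
  refine ⟨LinearMap.mk₂ ℝ (fun u v => T (D u) (D v) + chartMetric x G y (A (D u)) (D v)
    + chartMetric x G y (D u) (A (D v))) ?_ ?_ ?_ ?_, fun U V hU hV =>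
      (chart_lieExpr x G hy hX hU hV).symm⟩ <;> intros <;>
    simp only [map_add, map_smul, add_apply, smul_apply, smul_eq_mul] <;> ring

lemma lieDeriv_apply (G : RMetric E M) {X U V : VField E M} (hX : IsSmoothField X)
    (hU : IsSmoothField U) (hV : IsSmoothField V) (x : M) :
    lieDeriv X G.toCovTwo x (U x) (V x) = lieExpr G.toCovTwo X U V x := by
  have h := exists_lieExpr G hX x
  unfold lieExpr at h
  unfold lieDeriv
  rw [dif_pos h]
  exact h.choose_spec U V hU hV

/-- The vectors are extended to global fields, and by tensoriality only the values `a`, `b` of their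
chart expressions at `y` enter. -/
lemma chart_lieDeriv (p : M) (G : RMetric E M) {y : E} (hy : y ∈ (extChartAt 𝓘(ℝ, E) p).target)
    {X : VField E M} (hX : IsSmoothField X) (a b : E) :
    lieDeriv X G.toCovTwo ((extChartAt 𝓘(ℝ, E) p).symm y) (dchart E p y a) (dchart E p y b) =
      fderiv ℝ (chartMetric p G) y (chartField p X y) a b
        + chartMetric p G y (fderiv ℝ (chartField p X) y a) b
        + chartMetric p G y a (fderiv ℝ (chartField p X) y b) := by
  obtain ⟨U, hU, hUa⟩ := exists_isSmoothField ((extChartAt 𝓘(ℝ, E) p).symm y) (dchart E p y a)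
  obtain ⟨V, hV, hVb⟩ := exists_isSmoothField ((extChartAt 𝓘(ℝ, E) p).symm y) (dchart E p y b)
  have key {W : VField E M} {w : E}
      (hW : W ((extChartAt 𝓘(ℝ, E) p).symm y) = dchart E p y w) : chartField p W y = w := by
    change (dchart E p y).inverse (W ((extChartAt 𝓘(ℝ, E) p).symm y)) = w
    rw [hW]
    exact (isInvertible_dchart p hy).inverse_apply_self _
  rw [← hUa, ← hVb, lieDeriv_apply G hX hU hV, chart_lieExpr p G hy hX hU hV, key hUa, key hVb]

lemma dirDeriv_const_smul (c : ℝ) (X : VField E M) (f : M → ℝ) (x : M) :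
    dirDeriv (c • X) f x = c * dirDeriv X f x :=
  (mfderiv 𝓘(ℝ, E) 𝓘(ℝ, ℝ) f x).map_smul c (X x)

/-- Homogeneity in the field holds for constant factors, which is enough to extract `1/σ(t)` at a
fixed time. -/
lemma lieDeriv_const_smul (G : RMetric E M) {X : VField E M} (hX : IsSmoothField X) (c : ℝ)
    (x : M) (u v : TangentSpace 𝓘(ℝ, E) x) :
    lieDeriv (c • X) G.toCovTwo x u v = c * lieDeriv X G.toCovTwo x u v := by
  have := FiniteDimensional.complete ℝ E
  have : IsManifold 𝓘(ℝ, E) (minSmoothness ℝ 2) M :=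
    IsManifold.of_le (n := ∞) (by simpa using two_le_infty)
  obtain ⟨U, hU, rfl⟩ := exists_isSmoothField x u
  obtain ⟨V, hV, rfl⟩ := exists_isSmoothField x v
  rw [lieDeriv_apply G (hX.const_smul c) hU hV, lieDeriv_apply G hX hU hV]
  unfold lieExpr bracket
  rw [dirDeriv_const_smul, mlieBracket_const_smul_left (hX.mdifferentiableAt x),
    mlieBracket_const_smul_left (hX.mdifferentiableAt x)]
  simp only [RMetric.toCovTwo, map_smul, smul_apply, smul_eq_mul]
  ring

/-! ### The Levi-Civita connection -/

/-- The one-form `Z ↦ (D_X g)(Y, Z) + (D_Y g)(Z, X) - (D_Z g)(X, Y)` on the model space. -/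
def christoffelForm (g : E → E →L[ℝ] E →L[ℝ] ℝ) (X Y : E → E) (y : E) : E →L[ℝ] ℝ :=
  fderiv ℝ g y (X y) (Y y) + (fderiv ℝ g y (Y y)).flip (X y)
    - ((fderiv ℝ g y).flip (X y)).flip (Y y)

/-- The Levi-Civita connection of a metric on the model space. -/
def modelConnection (g : E → E →L[ℝ] E →L[ℝ] ℝ) (X Y : E → E) (y : E) : E :=
  fderiv ℝ Y y (X y) + (1 / 2 : ℝ) • (g y).inverse (christoffelForm g X Y y)

/-- Positive definiteness gives injectivity, and `E` and its dual have equal finite dimension. -/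
lemma isInvertible_chartMetric (p : M) (G : RMetric E M) {y : E}
    (hy : y ∈ (extChartAt 𝓘(ℝ, E) p).target) : (chartMetric p G y).IsInvertible := by
  have hinj : Function.Injective (chartMetric p G y) := by
    refine (injective_iff_map_eq_zero _).2 fun u hu => ?_
    by_contra hne
    have hne' : dchart E p y u ≠ 0 := fun h0 => hne <| by
      obtain ⟨D, hD⟩ := isInvertible_dchart p hy
      rw [← hD] at h0
      exact D.map_eq_zero_iff.1 h0
    have := G.pos ((extChartAt 𝓘(ℝ, E) p).symm y) (dchart E p y u) hne'
    rw [← chartMetric_apply, hu] at this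
    simp at this
  have hfin : Module.finrank ℝ E = Module.finrank ℝ (E →L[ℝ] ℝ) := by
    rw [← (LinearMap.toContinuousLinearMap (𝕜 := ℝ) (E := E) (F' := ℝ)).finrank_eq]
    exact (Subspace.dual_finrank_eq).symm
  exact ⟨(LinearEquiv.ofInjectiveOfFinrankEq (chartMetric p G y).toLinearMap hinj
    hfin).toContinuousLinearEquiv, by ext; rfl⟩

set_option maxSynthPendingDepth 5 in
lemma contDiffAt_modelConnection {g : E → E →L[ℝ] E →L[ℝ] ℝ} {X Y : E → E} {y : E}
    (hg : ContDiffAt ℝ ∞ g y) (hX : ContDiffAt ℝ ∞ X y) (hY : ContDiffAt ℝ ∞ Y y)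
    (hinv : (g y).IsInvertible) : ContDiffAt ℝ ∞ (modelConnection g X Y) y := by
  have := FiniteDimensional.complete ℝ E
  have hg' : ContDiffAt ℝ ∞ (fderiv ℝ g) y := hg.fderiv_right (by simp)
  have hY' : ContDiffAt ℝ ∞ (fderiv ℝ Y) y := hY.fderiv_right (by simp)
  have hω : ContDiffAt ℝ ∞ (christoffelForm g X Y) y := by
    refine (contMDiffAt_of_forall_apply fun z => ContDiffAt.contMDiffAt ?_).contDiffAt
    exact ((((hg'.clm_apply hX).clm_apply hY).clm_apply contDiffAt_const).add
      (((hg'.clm_apply hY).clm_apply contDiffAt_const).clm_apply hX)).sub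
      (((hg'.clm_apply (contDiffAt_const (c := z))).clm_apply hX).clm_apply hY)
  obtain ⟨e, he⟩ := hinv
  have hi : ContDiffAt ℝ ∞ (fun z => (g z).inverse) y := by
    have h := contDiffAt_map_inverse (n := ∞) e
    rw [he] at h
    exact h.comp y hg
  exact (hY'.clm_apply hX).add (contDiffAt_const.smul (hi.clm_apply hω))

lemma koszul_eq_modelConnection {g : E → E →L[ℝ] E →L[ℝ] ℝ} {X Y Z : E → E} {y : E}
    (hsymm : ∀ u v, g y u v = g y v u) (hg : DifferentiableAt ℝ g y)
    (hX : DifferentiableAt ℝ X y) (hY : DifferentiableAt ℝ Y y) (hZ : DifferentiableAt ℝ Z y)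
    (hinv : (g y).IsInvertible) :
    koszul (M := E) (modelTensor g) X Y Z y = 2 * g y (modelConnection g X Y y) (Z y) := by
  rw [koszul_model hsymm hg hX hY hZ, modelConnection]
  simp only [map_add, map_smul, add_apply, smul_apply, smul_eq_mul]
  rw [hinv.self_apply_inverse]
  simp [christoffelForm]
  ring

lemma RMetric.eq_of_forall_inner (G : RMetric E M) {x : M} {v w : TangentSpace 𝓘(ℝ, E) x}
    (h : ∀ Z : VField E M, IsSmoothField Z → G.toCovTwo x v (Z x) = G.toCovTwo x w (Z x)) :
    v = w := by
  obtain ⟨Z, hZ, hZx⟩ := exists_isSmoothField x (v - w)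
  by_contra hne
  have h1 := G.pos x (v - w) (sub_ne_zero.2 hne)
  have h2 := h Z hZ
  rw [hZx] at h2
  have h3 : G.inner x (v - w) (v - w) = G.inner x v (v - w) - G.inner x w (v - w) := by
    rw [map_sub (G.inner x) v w, sub_apply]
  rw [h3] at h1
  simp only [RMetric.toCovTwo] at h2
  linarith

lemma two_mul_inner_dchart_modelConnection (p : M) (G : RMetric E M) {y : E}
    (hy : y ∈ (extChartAt 𝓘(ℝ, E) p).target) {X Y Z : VField E M} (hX : IsSmoothField X)
    (hY : IsSmoothField Y) (hZ : IsSmoothField Z) :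
    2 * G.toCovTwo ((extChartAt 𝓘(ℝ, E) p).symm y)
        (dchart E p y (modelConnection (chartMetric p G) (chartField p X) (chartField p Y) y))
        (Z ((extChartAt 𝓘(ℝ, E) p).symm y)) =
      koszul G.toCovTwo X Y Z ((extChartAt 𝓘(ℝ, E) p).symm y) := by
  have := FiniteDimensional.complete ℝ E
  have h := koszul_mpullback G 1 (isLocalDiffeoNear_extChartAt_symm p hy)
    (hX.mdifferentiableAt _) (hY.mdifferentiableAt _) (hZ.mdifferentiableAt _)
  rw [one_mul, ← modelTensor_chartMetric] at h
  rw [← h, ← dchart_chartField p hy Z]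
  exact (koszul_eq_modelConnection (fun u v => G.symm _ _ _)
    ((contDiffAt_chartMetric p G hy).differentiableAt (by simp))
    ((contDiffAt_chartField p hy hX.contMDiffAt).differentiableAt (by simp))
    ((contDiffAt_chartField p hy hY.contMDiffAt).differentiableAt (by simp))
    ((contDiffAt_chartField p hy hZ.contMDiffAt).differentiableAt (by simp))
    (isInvertible_chartMetric p G hy)).symm

/-- By nondegeneracy the Koszul formula has at most one solution, so the chosen vector is any known
solution. -/
lemma leviCivita_eq_of_koszul (G : RMetric E M) {X Y : VField E M} {x : M}
    {v : TangentSpace 𝓘(ℝ, E) x}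
    (hv : ∀ Z : VField E M, IsSmoothField Z →
      2 * G.toCovTwo x v (Z x) = koszul G.toCovTwo X Y Z x) :
    leviCivita G.toCovTwo X Y x = v := by
  have h : ∃ v : TangentSpace 𝓘(ℝ, E) x, ∀ Z : VField E M, IsSmoothField Z →
      2 * G.toCovTwo x v (Z x) = koszul G.toCovTwo X Y Z x := ⟨v, hv⟩
  unfold leviCivita
  rw [dif_pos h]
  refine G.eq_of_forall_inner fun Z hZ => ?_
  have := h.choose_spec Z hZ
  linarith [hv Z hZ]

lemma leviCivita_chart (p : M) (G : RMetric E M) {y : E}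
    (hy : y ∈ (extChartAt 𝓘(ℝ, E) p).target) {X Y : VField E M} (hX : IsSmoothField X)
    (hY : IsSmoothField Y) :
    leviCivita G.toCovTwo X Y ((extChartAt 𝓘(ℝ, E) p).symm y) =
      dchart E p y (modelConnection (chartMetric p G) (chartField p X) (chartField p Y) y) :=
  leviCivita_eq_of_koszul G fun _ hZ => two_mul_inner_dchart_modelConnection p G hy hX hY hZ

lemma two_mul_inner_leviCivita (G : RMetric E M) {X Y Z : VField E M} (hX : IsSmoothField X)
    (hY : IsSmoothField Y) (hZ : IsSmoothField Z) (x : M) :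
    2 * G.toCovTwo x (leviCivita G.toCovTwo X Y x) (Z x) = koszul G.toCovTwo X Y Z x := by
  obtain ⟨y, hy, hyx⟩ : ∃ y ∈ (extChartAt 𝓘(ℝ, E) x).target,
      (extChartAt 𝓘(ℝ, E) x).symm y = x :=
    ⟨extChartAt 𝓘(ℝ, E) x x, mem_extChartAt_target x, extChartAt_to_inv x⟩
  have h := two_mul_inner_dchart_modelConnection x G hy hX hY hZ
  rw [← leviCivita_chart x G hy hX hY, hyx] at h
  exact h

/-- Near `x` the field is the image under the inverse chart of the smooth model connection.
Smoothness is needed because the curvature iterates the connection. -/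
lemma isSmoothField_leviCivita (G : RMetric E M) {X Y : VField E M} (hX : IsSmoothField X)
    (hY : IsSmoothField Y) : IsSmoothField (leviCivita G.toCovTwo X Y) := by
  have := FiniteDimensional.complete ℝ E
  intro x
  have hy := mem_extChartAt_target (I := 𝓘(ℝ, E)) x
  have hX' := contDiffAt_chartField x hy hX.contMDiffAt
  have hY' := contDiffAt_chartField x hy hY.contMDiffAt
  have h := contMDiffAt_dchart x hy (contDiffAt_modelConnection (contDiffAt_chartMetric x G hy)
    hX' hY' (isInvertible_chartMetric x G hy))
  refine (h.comp x (contMDiffAt_extChartAt (I := 𝓘(ℝ, E)))).congr_of_eventuallyEq ?_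
  filter_upwards [extChartAt_source_mem_nhds (I := 𝓘(ℝ, E)) x] with z hz
  have h1 := leviCivita_chart x G ((extChartAt 𝓘(ℝ, E) x).map_source hz) hX hY
  have h2 := (extChartAt 𝓘(ℝ, E) x).left_inv hz
  simp only [Function.comp]
  rw [← h1, h2]

end

section

variable {E : Type*} [NormedAddCommGroup E] [NormedSpace ℝ E] [FiniteDimensional ℝ E]
  {M : Type*} [TopologicalSpace M] [ChartedSpace E M] [IsManifold 𝓘(ℝ, E) ∞ M]

/-! ### Smoothness of sections of bundles of homomorphisms -/

/-- A field of linear maps on the tangent spaces is smooth if it maps smooth vector fields to smooth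
sections. -/
lemma contMDiffAt_hom_of_forall {F : Type*} [NormedAddCommGroup F] [NormedSpace ℝ F]
    {V : M → Type*} [∀ x, AddCommGroup (V x)] [∀ x, Module ℝ (V x)] [∀ x, TopologicalSpace (V x)]
    [∀ x, IsTopologicalAddGroup (V x)] [∀ x, ContinuousSMul ℝ (V x)]
    [TopologicalSpace (TotalSpace F V)] [FiberBundle F V] [VectorBundle ℝ F V]
    {A : (x : M) → TangentSpace 𝓘(ℝ, E) x →L[ℝ] V x} {x₀ : M}
    (h : ∀ U : VField E M, ContMDiffAt 𝓘(ℝ, E) 𝓘(ℝ, E).tangent ∞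
        (fun x => (⟨x, U x⟩ : TangentBundle 𝓘(ℝ, E) M)) x₀ →
      ContMDiffAt 𝓘(ℝ, E) (𝓘(ℝ, E).prod 𝓘(ℝ, F)) ∞
        (fun x => TotalSpace.mk' F x (A x (U x))) x₀) :
    ContMDiffAt 𝓘(ℝ, E) (𝓘(ℝ, E).prod 𝓘(ℝ, E →L[ℝ] F)) ∞
      (fun x => TotalSpace.mk' (E →L[ℝ] F)
        (E := fun x : M => TangentSpace 𝓘(ℝ, E) x →L[ℝ] V x) x (A x)) x₀ := by
  rw [contMDiffAt_hom_bundle]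
  refine ⟨contMDiffAt_id, contMDiffAt_of_forall_apply fun v => ?_⟩
  set t := trivializationAt E (fun x : M => TangentSpace 𝓘(ℝ, E) x) x₀ with ht
  have hx₀ : x₀ ∈ t.baseSet := FiberBundle.mem_baseSet_trivializationAt' x₀
  -- The test field is constant, equal to `v`, in the trivialization at `x₀`, so its image reads off
  -- the value at `v` of `A` in coordinates.
  have h1 := h _ (FiberBundle.contMDiffAt_extend (k := ∞) 𝓘(ℝ, E) E (t.symm x₀ v))
  rw [contMDiffAt_section] at h1
  refine h1.congr_of_eventuallyEq ?_
  have hx₀' := FiberBundle.mem_baseSet_trivializationAt' (F := F) (E := V) x₀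
  filter_upwards [t.open_baseSet.mem_nhds hx₀,
    (trivializationAt F V x₀).open_baseSet.mem_nhds hx₀'] with x hx hx'
  simp [ContinuousLinearMap.inCoordinates, FiberBundle.extend, ← ht,
    Trivialization.coe_linearMapAt_of_mem _ hx', t.symmL_apply hx, hx₀]

/-! ### Pullbacks by diffeomorphisms -/

section Diffeo

variable (ψ : M ≃ₘ⟮𝓘(ℝ, E), 𝓘(ℝ, E)⟯ M)

/-- The derivative of a diffeomorphism. -/
abbrev dequiv (x : M) : TangentSpace 𝓘(ℝ, E) x ≃L[ℝ] TangentSpace 𝓘(ℝ, E) (ψ x) :=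
  ψ.mfderivToContinuousLinearEquiv (by simp) x

lemma isInvertible_mfderiv (x : M) : (mfderiv 𝓘(ℝ, E) 𝓘(ℝ, E) ψ x).IsInvertible :=
  ⟨dequiv ψ x, rfl⟩

lemma mfderiv_inverse_apply (x : M) (u : TangentSpace 𝓘(ℝ, E) (ψ x)) :
    (mfderiv 𝓘(ℝ, E) 𝓘(ℝ, E) ψ x).inverse u = (dequiv ψ x).symm u :=
  congrArg (fun A => A u) (ContinuousLinearMap.inverse_equiv (dequiv ψ x))

lemma isLocalDiffeoNear (x : M) : IsLocalDiffeoNear (E := E) ψ x where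
  contMDiffAt := ψ.contMDiff.contMDiffAt
  isInvertible := .of_forall (isInvertible_mfderiv ψ)

lemma mfderiv_pullField (X : VField E M) (x : M) :
    mfderiv 𝓘(ℝ, E) 𝓘(ℝ, E) ψ x (pullField ψ X x) = X (ψ x) :=
  mfderiv_mpullback (isInvertible_mfderiv ψ x) X

/-- Pulling back by the inverse is pushing forward, by the chain rule for `ψ.symm ∘ ψ = id`. -/
lemma pullField_symm_apply (U : VField E M) (x : M) :
    pullField ψ.symm U (ψ x) = mfderiv 𝓘(ℝ, E) 𝓘(ℝ, E) ψ x (U x) := by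
  have h1 : mfderiv 𝓘(ℝ, E) 𝓘(ℝ, E) ψ.symm (ψ x) (pullField ψ.symm U (ψ x)) =
      U (ψ.symm (ψ x)) := mfderiv_pullField ψ.symm U (ψ x)
  have h2 : (mfderiv 𝓘(ℝ, E) 𝓘(ℝ, E) ψ.symm (ψ x)).comp (mfderiv 𝓘(ℝ, E) 𝓘(ℝ, E) ψ x) =
      ContinuousLinearMap.id ℝ (TangentSpace 𝓘(ℝ, E) x) := by
    have h := mfderiv_comp x (ψ.symm.contMDiff.mdifferentiableAt (x := ψ x) (by simp))
      (ψ.contMDiff.mdifferentiableAt (x := x) (by simp))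
    have hid : (ψ.symm : M → M) ∘ ψ = id := by
      funext z
      simp
    rw [hid, mfderiv_id] at h
    exact h.symm
  have h3 : (U (ψ.symm (ψ x)) : E) = U x :=
    congrArg (fun z => (U z : E)) (ψ.symm_apply_apply x)
  refine (dequiv ψ.symm (ψ x)).injective ?_
  refine h1.trans (h3.trans ?_)
  exact (congrArg (fun A : E →L[ℝ] E => A (U x)) h2).symm

lemma pullField_pullField_symm (U : VField E M) : pullField ψ (pullField ψ.symm U) = U := by
  funext x
  change (mfderiv 𝓘(ℝ, E) 𝓘(ℝ, E) ψ x).inverse (pullField ψ.symm U (ψ x)) = U x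
  rw [pullField_symm_apply]
  exact (isInvertible_mfderiv ψ x).inverse_apply_self _

variable {ψ}

lemma contMDiffAt_pullField {X : VField E M} {x : M}
    (hX : ContMDiffAt 𝓘(ℝ, E) 𝓘(ℝ, E).tangent ∞
      (fun x => (⟨x, X x⟩ : TangentBundle 𝓘(ℝ, E) M)) (ψ x)) :
    ContMDiffAt 𝓘(ℝ, E) 𝓘(ℝ, E).tangent ∞
      (fun x => (⟨x, pullField ψ X x⟩ : TangentBundle 𝓘(ℝ, E) M)) x := by
  have := FiniteDimensional.complete ℝ E
  exact ContMDiffAt.mpullback_vectorField_preimage (m := ∞) (n := ∞) hX ψ.contMDiff.contMDiffAt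
    (isInvertible_mfderiv ψ x) (by simp)

lemma contMDiffAt_mfderiv_apply {U : VField E M} {x : M}
    (hU : ContMDiffAt 𝓘(ℝ, E) 𝓘(ℝ, E).tangent ∞
      (fun x => (⟨x, U x⟩ : TangentBundle 𝓘(ℝ, E) M)) x) :
    ContMDiffAt 𝓘(ℝ, E) 𝓘(ℝ, E).tangent ∞
      (fun x => (⟨ψ x, mfderiv 𝓘(ℝ, E) 𝓘(ℝ, E) ψ x (U x)⟩ : TangentBundle 𝓘(ℝ, E) M)) x :=
  (ψ.contMDiff.contMDiff_tangentMap (m := ∞) (by simp)).contMDiffAt.comp x hU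

/-- The pullback of a smooth endomorphism field is smooth. -/
lemma contMDiff_pullEnd {φ : EndField E M}
    (hφ : ContMDiff 𝓘(ℝ, E) (𝓘(ℝ, E).prod 𝓘(ℝ, E →L[ℝ] E)) ∞
      (fun x => TotalSpace.mk' (E →L[ℝ] E)
        (E := fun x : M => TangentSpace 𝓘(ℝ, E) x →L[ℝ] TangentSpace 𝓘(ℝ, E) x) x (φ x))) :
    ContMDiff 𝓘(ℝ, E) (𝓘(ℝ, E).prod 𝓘(ℝ, E →L[ℝ] E)) ∞
      (fun x => TotalSpace.mk' (E →L[ℝ] E)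
        (E := fun x : M => TangentSpace 𝓘(ℝ, E) x →L[ℝ] TangentSpace 𝓘(ℝ, E) x) x
        (pullEnd ψ φ x)) := by
  intro x₀
  refine contMDiffAt_hom_of_forall (V := fun x : M => TangentSpace 𝓘(ℝ, E) x) fun U hU => ?_
  -- The idea is to write `(ψ^*φ) U = ψ^*(φ(ψ_* U))`, a composite of operations that preserve
  -- smoothness.
  have h1 : ContMDiffAt 𝓘(ℝ, E) 𝓘(ℝ, E).tangent ∞
      (fun x => (⟨x, pullField ψ.symm U x⟩ : TangentBundle 𝓘(ℝ, E) M)) (ψ x₀) :=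
    contMDiffAt_pullField (by rwa [ψ.symm_apply_apply])
  have h2 := ContMDiffAt.clm_bundle_apply (hφ (ψ x₀)) h1
  have h3 := contMDiffAt_pullField (X := fun x => φ x (pullField ψ.symm U x)) h2
  refine h3.congr_of_eventuallyEq (.of_forall fun x => ?_)
  have : pullEnd ψ φ x (U x) = pullField ψ (fun x => φ x (pullField ψ.symm U x)) x := by
    change _ = (mfderiv 𝓘(ℝ, E) 𝓘(ℝ, E) ψ x).inverse (φ (ψ x) (pullField ψ.symm U (ψ x)))
    rw [pullField_symm_apply]
    rfl
  exact congrArg (fun w => (⟨x, w⟩ : TangentBundle 𝓘(ℝ, E) M)) this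

/-- A multiple of the pullback of a smooth one-form is smooth. -/
lemma contMDiff_smul_pullForm (c : ℝ) {η : OneForm E M}
    (hη : ContMDiff 𝓘(ℝ, E) (𝓘(ℝ, E).prod 𝓘(ℝ, E →L[ℝ] ℝ)) ∞
      (fun x => TotalSpace.mk' (E →L[ℝ] ℝ)
        (E := fun x : M => TangentSpace 𝓘(ℝ, E) x →L[ℝ] ℝ) x (η x))) :
    ContMDiff 𝓘(ℝ, E) (𝓘(ℝ, E).prod 𝓘(ℝ, E →L[ℝ] ℝ)) ∞
      (fun x => TotalSpace.mk' (E →L[ℝ] ℝ)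
        (E := fun x : M => TangentSpace 𝓘(ℝ, E) x →L[ℝ] ℝ) x ((c • pullForm ψ η) x)) := by
  intro x₀
  refine contMDiffAt_hom_of_forall (V := Bundle.Trivial M ℝ) fun U hU => ?_
  have h1 : ContMDiffAt 𝓘(ℝ, E) (𝓘(ℝ, E).prod 𝓘(ℝ)) ∞
      (fun x ↦ TotalSpace.mk' ℝ (E := Bundle.Trivial M ℝ) (ψ x)
        (η (ψ x) (mfderiv 𝓘(ℝ, E) 𝓘(ℝ, E) ψ x (U x)))) x₀ :=
    ContMDiffAt.clm_bundle_apply (F₁ := E) ((hη (ψ x₀)).comp x₀ ψ.contMDiff.contMDiffAt)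
      (contMDiffAt_mfderiv_apply hU)
  rw [contMDiffAt_totalSpace] at h1 ⊢
  exact ⟨contMDiffAt_id, (contMDiffAt_const (c := c)).mul h1.2⟩

variable (ψ)

/-- The Riemannian metric `c ψ^* G`, for `c > 0`. -/
def pullMetric (G : RMetric E M) {c : ℝ} (hc : 0 < c) : RMetric E M where
  inner x :=
    let A : E →L[ℝ] E →L[ℝ] ℝ := G.inner (ψ x)
    let D : E →L[ℝ] E := mfderiv 𝓘(ℝ, E) 𝓘(ℝ, E) ψ x
    c • A.bilinearComp D D
  symm x v w := congrArg (c * ·) (G.symm (ψ x) _ _)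
  pos x v hv := mul_pos hc (G.pos (ψ x) _ fun h => hv ((dequiv ψ x).map_eq_zero_iff.1 h))
  isVonNBounded x := by
    -- The unit ball of `c ψ^* G` lies in the image of the unit ball of `G` under `c^(-1/2) (dψ)⁻¹`.
    refine ((G.isVonNBounded (ψ x)).image ((√c)⁻¹ • ((dequiv ψ x).symm :
      TangentSpace 𝓘(ℝ, E) (ψ x) →L[ℝ] TangentSpace 𝓘(ℝ, E) x))).subset fun v hv => ?_
    have hs : √c ≠ 0 := (Real.sqrt_pos.2 hc).ne'
    refine ⟨√c • dequiv ψ x v, ?_, ?_⟩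
    · have h1 : G.inner (ψ x) (√c • dequiv ψ x v) (√c • dequiv ψ x v) =
          c * G.inner (ψ x) (dequiv ψ x v) (dequiv ψ x v) := by
        rw [map_smul, map_smul, smul_apply, smul_eq_mul, smul_eq_mul, ← mul_assoc,
          Real.mul_self_sqrt hc.le]
      exact h1.trans_lt hv
    · simp [smul_smul, hs]
  contMDiff x₀ := by
    refine contMDiffAt_hom_of_forall
      (V := fun x : M => TangentSpace 𝓘(ℝ, E) x →L[ℝ] Bundle.Trivial M ℝ x) fun U hU => ?_
    refine contMDiffAt_hom_of_forall (V := Bundle.Trivial M ℝ) fun W hW => ?_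
    rw [contMDiffAt_totalSpace]
    refine ⟨contMDiffAt_id, ?_⟩
    have h := contMDiffAt_inner ((G.contMDiff (ψ x₀)).comp x₀ ψ.contMDiff.contMDiffAt)
      (contMDiffAt_mfderiv_apply hU) (contMDiffAt_mfderiv_apply hW)
    exact (contMDiffAt_const (c := c)).mul h

lemma toCovTwo_pullMetric (G : RMetric E M) {c : ℝ} (hc : 0 < c) :
    (pullMetric ψ G hc).toCovTwo = scaledPullback c ψ G.toCovTwo := by
  rfl

end Diffeo

end

section

variable {E : Type*} [NormedAddCommGroup E] [NormedSpace ℝ E] [FiniteDimensional ℝ E]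
  {M : Type*} [TopologicalSpace M] [T2Space M] [ChartedSpace E M] [IsManifold 𝓘(ℝ, E) ∞ M]
  (ψ : M ≃ₘ⟮𝓘(ℝ, E), 𝓘(ℝ, E)⟯ M) (G : RMetric E M) {c : ℝ} (hc : 0 < c)

/-! ### Naturality of the Levi-Civita connection and of the curvature -/

lemma IsSmoothField.bracket {X Y : VField E M} (hX : IsSmoothField X) (hY : IsSmoothField Y) :
    IsSmoothField (bracket X Y) := by
  have := FiniteDimensional.complete ℝ E
  have : IsManifold 𝓘(ℝ, E) (((⊤ : ℕ∞) : ℕ∞ω) + 1) M := IsManifold.of_le (n := ∞) (by simp)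
  have : IsManifold 𝓘(ℝ, E) (minSmoothness ℝ 3) M :=
    IsManifold.of_le (n := ∞) (by
      simpa using (WithTop.coe_le_coe.2 (le_top : (3 : ℕ∞) ≤ ⊤)))
  exact ContDiff.mlieBracket_vectorField (m := ⊤) (n := ⊤) hX hY (by simp)

lemma bracket_pullField {X Y : VField E M} (hX : IsSmoothField X) (hY : IsSmoothField Y) :
    bracket (pullField ψ X) (pullField ψ Y) = pullField ψ (bracket X Y) := by
  have := FiniteDimensional.complete ℝ E
  have : IsManifold 𝓘(ℝ, E) (minSmoothness ℝ 2) M :=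
    IsManifold.of_le (n := ∞) (by simpa using two_le_infty)
  funext x
  exact (mpullback_mlieBracket (hX.mdifferentiableAt _) (hY.mdifferentiableAt _)
    (ψ.contMDiff.contMDiffAt (x := x)) (by simpa using two_le_infty)).symm

/-- The factor `c` multiplies both sides of the Koszul formula and drops out. Every test field is a
pullback, so it suffices to test on pullbacks. -/
lemma leviCivita_pullField {X Y : VField E M} (hX : IsSmoothField X) (hY : IsSmoothField Y) :
    leviCivita (pullMetric ψ G hc).toCovTwo (pullField ψ X) (pullField ψ Y) =
      pullField ψ (leviCivita G.toCovTwo X Y) := by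
  have := FiniteDimensional.complete ℝ E
  funext x
  refine leviCivita_eq_of_koszul _ fun Z hZ => ?_
  have hZ' : IsSmoothField (pullField ψ.symm Z) := hZ.pullField ψ.symm
  rw [← pullField_pullField_symm ψ Z, toCovTwo_pullMetric]
  refine Eq.trans ?_ (koszul_mpullback G c (isLocalDiffeoNear ψ x) (hX.mdifferentiableAt _)
    (hY.mdifferentiableAt _) (hZ'.mdifferentiableAt _)).symm
  rw [← two_mul_inner_leviCivita G hX hY hZ', scaledPullback, mfderiv_pullField,
    mfderiv_pullField]
  ring

lemma pullField_sub (X Y : VField E M) :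
    pullField ψ (X - Y) = pullField ψ X - pullField ψ Y := by
  funext x
  exact map_sub (mfderiv 𝓘(ℝ, E) 𝓘(ℝ, E) ψ x).inverse (X (ψ x)) (Y (ψ x))

lemma curvatureField_pullField {X Y Z : VField E M} (hX : IsSmoothField X) (hY : IsSmoothField Y)
    (hZ : IsSmoothField Z) :
    curvatureField (pullMetric ψ G hc).toCovTwo (pullField ψ X) (pullField ψ Y) (pullField ψ Z) =
      pullField ψ (curvatureField G.toCovTwo X Y Z) := by
  unfold curvatureField
  rw [leviCivita_pullField ψ G hc hY hZ, leviCivita_pullField ψ G hc hX hZ,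
    leviCivita_pullField ψ G hc hX (isSmoothField_leviCivita G hY hZ),
    leviCivita_pullField ψ G hc hY (isSmoothField_leviCivita G hX hZ),
    bracket_pullField ψ hX hY, leviCivita_pullField ψ G hc (hX.bracket hY) hZ,
    pullField_sub, pullField_sub]

/-- `R` is the value at `x` of the curvature tensor of `g`. -/
def IsCurvatureAt (g : CovTwo E M) (x : M)
    (R : TangentSpace 𝓘(ℝ, E) x →ₗ[ℝ] TangentSpace 𝓘(ℝ, E) x →ₗ[ℝ]
      TangentSpace 𝓘(ℝ, E) x →ₗ[ℝ] TangentSpace 𝓘(ℝ, E) x) : Prop :=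
  ∀ X Y Z : VField E M, IsSmoothField X → IsSmoothField Y → IsSmoothField Z →
    R (X x) (Y x) (Z x) = curvatureField g X Y Z x

lemma IsCurvatureAt.curvature_eq {g : CovTwo E M} {x : M}
    {R : TangentSpace 𝓘(ℝ, E) x →ₗ[ℝ] TangentSpace 𝓘(ℝ, E) x →ₗ[ℝ]
      TangentSpace 𝓘(ℝ, E) x →ₗ[ℝ] TangentSpace 𝓘(ℝ, E) x} (hR : IsCurvatureAt g x R) :
    curvature g x = R := by
  have h : ∃ R, IsCurvatureAt g x R := ⟨R, hR⟩
  have h1 : IsCurvatureAt g x (curvature g x) := by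
    unfold IsCurvatureAt at h
    unfold curvature
    rw [dif_pos h]
    exact h.choose_spec
  ext u v w
  obtain ⟨U, hU, rfl⟩ := exists_isSmoothField x u
  obtain ⟨V, hV, rfl⟩ := exists_isSmoothField x v
  obtain ⟨W, hW, rfl⟩ := exists_isSmoothField x w
  rw [h1 U V W hU hV hW, hR U V W hU hV hW]

lemma curvature_eq_zero {g : CovTwo E M} {x : M} (h : ¬ ∃ R, IsCurvatureAt g x R) :
    curvature g x = 0 := by
  unfold IsCurvatureAt at h
  unfold curvature
  rw [dif_neg h]

/-- Transport of a trilinear map along a linear equivalence. -/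
lemma exists_conj_trilinear {V W : Type*} [AddCommGroup V] [Module ℝ V] [AddCommGroup W]
    [Module ℝ W] (D : V ≃ₗ[ℝ] W) (R : W →ₗ[ℝ] W →ₗ[ℝ] W →ₗ[ℝ] W) :
    ∃ R' : V →ₗ[ℝ] V →ₗ[ℝ] V →ₗ[ℝ] V, ∀ u v w, R' u v w = D.symm (R (D u) (D v) (D w)) := by
  refine ⟨LinearMap.mk₂ ℝ (fun u v => D.symm.toLinearMap ∘ₗ R (D u) (D v) ∘ₗ D.toLinearMap)
    ?_ ?_ ?_ ?_, fun u v w => rfl⟩ <;> intros <;> ext <;> simp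

/-- Conjugation by `dψ` carries a trilinear map representing one curvature to one representing the
other, in both directions. Either both exist and correspond, or both curvatures take the default
value `0`, so tensoriality of the curvature is not needed. -/
lemma curvature_pullMetric (x : M) (u v w : TangentSpace 𝓘(ℝ, E) x) :
    curvature (pullMetric ψ G hc).toCovTwo x u v w =
      (dequiv ψ x).symm (curvature G.toCovTwo (ψ x) (dequiv ψ x u) (dequiv ψ x v)
        (dequiv ψ x w)) := by
  have hpush (X : VField E M) : pullField ψ.symm X (ψ x) = dequiv ψ x (X x) :=
    pullField_symm_apply ψ X x
  have hpull (X : VField E M) : dequiv ψ x (pullField ψ X x) = X (ψ x) :=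
    mfderiv_pullField ψ X x
  have hfield (X Y Z : VField E M) (hX : IsSmoothField X) (hY : IsSmoothField Y)
      (hZ : IsSmoothField Z) :
      dequiv ψ x (curvatureField (pullMetric ψ G hc).toCovTwo (pullField ψ X) (pullField ψ Y)
        (pullField ψ Z) x) = curvatureField G.toCovTwo X Y Z (ψ x) := by
    rw [curvatureField_pullField ψ G hc hX hY hZ, hpull]
  by_cases h : ∃ R, IsCurvatureAt G.toCovTwo (ψ x) R
  · obtain ⟨R, hR⟩ := h
    obtain ⟨R', hR'⟩ := exists_conj_trilinear (dequiv ψ x).toLinearEquiv R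
    have h' : IsCurvatureAt (pullMetric ψ G hc).toCovTwo x R' := by
      intro X Y Z hX hY hZ
      rw [hR']
      have h1 := hfield _ _ _ (hX.pullField ψ.symm) (hY.pullField ψ.symm) (hZ.pullField ψ.symm)
      rw [pullField_pullField_symm, pullField_pullField_symm, pullField_pullField_symm] at h1
      have h2 := hR _ _ _ (hX.pullField ψ.symm) (hY.pullField ψ.symm) (hZ.pullField ψ.symm)
      rw [← h1, hpush, hpush, hpush] at h2
      exact (LinearEquiv.symm_apply_eq _).2 h2
    rw [h'.curvature_eq, hR.curvature_eq, hR']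
    rfl
  · have h' : ¬ ∃ R, IsCurvatureAt (pullMetric ψ G hc).toCovTwo x R := by
      rintro ⟨R', hR'⟩
      obtain ⟨R, hR⟩ := exists_conj_trilinear (dequiv ψ x).toLinearEquiv.symm R'
      refine h ⟨R, fun X Y Z hX hY hZ => ?_⟩
      rw [hR, ← hfield X Y Z hX hY hZ, ← hR' _ _ _ (hX.pullField ψ) (hY.pullField ψ)
        (hZ.pullField ψ), ← hpull X, ← hpull Y, ← hpull Z]
      simp
    rw [curvature_eq_zero h, curvature_eq_zero h']
    simp

/-- Naturality of the `*`-Ricci tensor, and its invariance under scaling of the metric. -/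
lemma starRicci_pullMetric (φ : EndField E M) (x : M) (u v : TangentSpace 𝓘(ℝ, E) x) :
    starRicci (pullMetric ψ G hc).toCovTwo (pullEnd ψ φ) x u v =
      pullTwo ψ (starRicci G.toCovTwo φ) x u v := by
  have hφ (w : TangentSpace 𝓘(ℝ, E) x) :
      pullEnd ψ φ x w = (dequiv ψ x).symm (φ (ψ x) (dequiv ψ x w)) :=
    mfderiv_inverse_apply ψ x _
  unfold pullTwo starRicci
  congr 1
  -- The two endomorphisms are conjugate under `dψ`, and the trace is invariant under conjugation.
  rw [← LinearMap.trace_conj' _ (dequiv ψ x).toLinearEquiv.symm]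
  congr 1
  ext w
  change curvature (pullMetric ψ G hc).toCovTwo x u (pullEnd ψ φ x v) (pullEnd ψ φ x w) =
    (dequiv ψ x).symm (curvature G.toCovTwo (ψ x) (dequiv ψ x u) (φ (ψ x) (dequiv ψ x v))
      (φ (ψ x) (dequiv ψ x w)))
  rw [curvature_pullMetric, hφ, hφ, ContinuousLinearEquiv.apply_symm_apply,
    ContinuousLinearEquiv.apply_symm_apply]

end

section

variable {E : Type*} [NormedAddCommGroup E] [NormedSpace ℝ E]

/-! ### The time derivative of a pulled-back metric -/

lemma hasDerivAt_comp_prodMk {V : Type*} [NormedAddCommGroup V] [NormedSpace ℝ V] {Q : ℝ × E → V}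
    {f : ℝ → E} {f' : E} {t : ℝ} (hQ : DifferentiableAt ℝ Q (t, f t)) (hf : HasDerivAt f f' t) :
    HasDerivAt (fun s => Q (s, f s)) (fderiv ℝ Q (t, f t) (1, f')) t :=
  HasFDerivAt.comp_hasDerivAt (f := fun s => (s, f s)) t hQ.hasFDerivAt
    ((hasDerivAt_id t).prodMk hf)

lemma hasFDerivAt_slice {V : Type*} [NormedAddCommGroup V] [NormedSpace ℝ V] {Q : ℝ × E → V}
    {t : ℝ} {y : E} (hQ : DifferentiableAt ℝ Q (t, y)) :
    HasFDerivAt (fun z => Q (t, z)) ((fderiv ℝ Q (t, y)).comp (ContinuousLinearMap.inr ℝ ℝ E)) y :=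
  HasFDerivAt.comp (f := fun z => (t, z)) y hQ.hasFDerivAt (hasFDerivAt_prodMk_right t y)

set_option maxSynthPendingDepth 5 in
/-- The model space version of the formula for the time derivative of a pulled-back family. -/
lemma hasDerivAt_pullback_model {F : ℝ × E → E} {Q : ℝ × E → E →L[ℝ] E →L[ℝ] ℝ} {X : E → E} {t : ℝ}
    {y : E} (hF : ContDiffAt ℝ ∞ F (t, y)) (hQ : DifferentiableAt ℝ Q (t, F (t, y)))
    (hX : DifferentiableAt ℝ X (F (t, y)))
    (hvel : ∀ᶠ z in 𝓝 y, fderiv ℝ F (t, z) (1, 0) = X (F (t, z))) {u v a b : E}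
    (ha : fderiv ℝ F (t, y) (0, u) = a) (hb : fderiv ℝ F (t, y) (0, v) = b) :
    HasDerivAt (fun s => Q (s, F (s, y)) (fderiv ℝ F (s, y) (0, u)) (fderiv ℝ F (s, y) (0, v)))
      (deriv (fun s => Q (s, F (t, y)) a b) t
        + (fderiv ℝ (fun z => Q (t, z)) (F (t, y)) (X (F (t, y))) a b
          + Q (t, F (t, y)) (fderiv ℝ X (F (t, y)) a) b
          + Q (t, F (t, y)) a (fderiv ℝ X (F (t, y)) b))) t := by
  have hFd : DifferentiableAt ℝ F (t, y) := hF.differentiableAt (by simp)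
  have hF2 : DifferentiableAt ℝ (fderiv ℝ F) (t, y) :=
    (hF.fderiv_right (m := ∞) (by simp)).differentiableAt (by simp)
  have hFt : HasDerivAt (fun s => F (s, y)) (X (F (t, y))) t := by
    rw [← hvel.self_of_nhds]
    exact hasDerivAt_comp_prodMk hFd (hasDerivAt_const t y)
  have hsymm : IsSymmSndFDerivAt ℝ F (t, y) :=
    hF.isSymmSndFDerivAt (by simpa using two_le_infty)
  -- After exchanging the two derivatives, the velocity equation is differentiated in space. This is
  -- why `hvel` is required on a neighbourhood of `y`.
  have hspace (w : E) : fderiv ℝ (fderiv ℝ F) (t, y) (1, 0) (0, w) =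
      fderiv ℝ X (F (t, y)) (fderiv ℝ F (t, y) (0, w)) := by
    rw [hsymm.eq]
    have h0 : HasFDerivAt (fun z => fderiv ℝ F (t, z))
        ((fderiv ℝ (fderiv ℝ F) (t, y)).comp (ContinuousLinearMap.inr ℝ ℝ E)) y :=
      hasFDerivAt_slice hF2
    have h1 := h0.clm_apply (hasFDerivAt_const ((1, 0) : ℝ × E) y)
    have h2 : HasFDerivAt (fun z => X (F (t, z))) _ y :=
      hX.hasFDerivAt.comp y (hasFDerivAt_slice hFd)
    have h3 := congrArg (fun A : E →L[ℝ] E => A w) (h1.unique (h2.congr_of_eventuallyEq hvel))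
    simpa only [add_apply, ContinuousLinearMap.comp_apply, ContinuousLinearMap.flip_apply,
      zero_apply, map_zero, zero_add, ContinuousLinearMap.inr_apply] using h3
  have hD (w : E) : HasDerivAt (fun s => fderiv ℝ F (s, y) (0, w))
      (fderiv ℝ X (F (t, y)) (fderiv ℝ F (t, y) (0, w))) t := by
    rw [← hspace]
    have h : HasDerivAt (fun s => fderiv ℝ F (s, y)) (fderiv ℝ (fderiv ℝ F) (t, y) (1, 0)) t :=
      hasDerivAt_comp_prodMk hF2 (hasDerivAt_const t y)
    exact (h.clm_apply (hasDerivAt_const t ((0, w) : ℝ × E))).congr_deriv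
      (by rw [map_zero, add_zero])
  have hQc : HasDerivAt (fun s => Q (s, F (s, y))) (fderiv ℝ Q (t, F (t, y)) (1, X (F (t, y)))) t :=
    hasDerivAt_comp_prodMk (V := E →L[ℝ] E →L[ℝ] ℝ) hQ hFt
  have hQ1 : HasDerivAt (fun s => Q (s, F (t, y)) a b) (fderiv ℝ Q (t, F (t, y)) (1, 0) a b) t := by
    have h1 : HasDerivAt (fun s => Q (s, F (t, y))) (fderiv ℝ Q (t, F (t, y)) (1, 0)) t :=
      hasDerivAt_comp_prodMk (V := E →L[ℝ] E →L[ℝ] ℝ) hQ (hasDerivAt_const t _)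
    exact ((h1.clm_apply (hasDerivAt_const t a)).clm_apply (hasDerivAt_const t b)).congr_deriv
      (by rw [map_zero, map_zero, add_zero, add_zero])
  have hQ2 : HasFDerivAt (fun z => Q (t, z)) ((fderiv ℝ Q (t, F (t, y))).comp
      (ContinuousLinearMap.inr ℝ ℝ E)) (F (t, y)) :=
    hasFDerivAt_slice (V := E →L[ℝ] E →L[ℝ] ℝ) hQ
  -- The time part gives `∂g/∂t`, and the space part gives the transport term of the Lie derivative.
  have hsplit : fderiv ℝ Q (t, F (t, y)) (1, X (F (t, y))) =
      fderiv ℝ Q (t, F (t, y)) (1, 0) + fderiv ℝ Q (t, F (t, y)) (0, X (F (t, y))) := by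
    rw [← map_add]
    simp
  have h := (hQc.clm_apply (hD u)).clm_apply (hD v)
  rw [hQ1.deriv, hQ2.fderiv]
  refine h.congr_deriv ?_
  rw [hsplit, ha, hb]
  simp only [ContinuousLinearMap.comp_apply, ContinuousLinearMap.inr_apply, add_apply]
  ring

variable [FiniteDimensional ℝ E] {M : Type*} [TopologicalSpace M] [T2Space M] [ChartedSpace E M]
  [IsManifold 𝓘(ℝ, E) ∞ M]

lemma dchart_mfderiv_extChartAt (p : M) {q : M} (hq : q ∈ (extChartAt 𝓘(ℝ, E) p).source)
    (w : TangentSpace 𝓘(ℝ, E) q) :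
    dchart E p (extChartAt 𝓘(ℝ, E) p q) (mfderiv 𝓘(ℝ, E) 𝓘(ℝ, E) (extChartAt 𝓘(ℝ, E) p) q w) =
      w := by
  have h := mfderivWithin_extChartAt_symm_comp_mfderiv_extChartAt' (I := 𝓘(ℝ, E)) hq
  rw [ModelWithCorners.range_eq_univ, mfderivWithin_univ] at h
  exact congrArg (fun A : E →L[ℝ] E => A w) h

lemma chartField_extChartAt (p : M) {q : M} (hq : q ∈ (extChartAt 𝓘(ℝ, E) p).source)
    (X : VField E M) :
    chartField p X (extChartAt 𝓘(ℝ, E) p q) =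
      mfderiv 𝓘(ℝ, E) 𝓘(ℝ, E) (extChartAt 𝓘(ℝ, E) p) q (X q) := by
  have hinv := isInvertible_dchart p ((extChartAt 𝓘(ℝ, E) p).map_source hq)
  have h1 : (X ((extChartAt 𝓘(ℝ, E) p).symm (extChartAt 𝓘(ℝ, E) p q)) : E) = X q :=
    congrArg (fun z => (X z : E)) ((extChartAt 𝓘(ℝ, E) p).left_inv hq)
  have h2 := dchart_mfderiv_extChartAt p hq (X q)
  change (dchart E p (extChartAt 𝓘(ℝ, E) p q)).inverse
    (X ((extChartAt 𝓘(ℝ, E) p).symm (extChartAt 𝓘(ℝ, E) p q))) = _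
  refine (congrArg _ (h1.trans h2.symm)).trans ?_
  exact hinv.inverse_apply_self _

/-- Taking `a`, `b` in `E`, to which every tangent space reduces, allows the base point to be
changed without casts. -/
lemma apply_extChartAt_symm (B : CovTwo E M) (p : M) {q : M}
    (hq : q ∈ (extChartAt 𝓘(ℝ, E) p).source) (a b : E) :
    B ((extChartAt 𝓘(ℝ, E) p).symm (extChartAt 𝓘(ℝ, E) p q)) a b = B q a b :=
  congrArg (fun z => (B z : E → E → ℝ) a b) ((extChartAt 𝓘(ℝ, E) p).left_inv hq)

/-! ### Generated families of diffeomorphisms read in charts -/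

section Flow

variable {J : Set ℝ} {ψ : ℝ → (M ≃ₘ⟮𝓘(ℝ, E), 𝓘(ℝ, E)⟯ M)} {X : ℝ → VField E M} {t : ℝ}

variable (ψ t) in
/-- The flow near `(t, x)` in the charts at `x` and `ψ t x`. -/
def chartFlow (x : M) (q : ℝ × E) : E :=
  extChartAt 𝓘(ℝ, E) (ψ t x) (ψ q.1 ((extChartAt 𝓘(ℝ, E) x).symm q.2))

lemma IsGeneratedBy.contMDiffAt (hψ : IsGeneratedBy J ψ X) (hJ : IsOpen J) (ht : t ∈ J)
    (x : M) :
    ContMDiffAt (𝓘(ℝ, ℝ).prod 𝓘(ℝ, E)) 𝓘(ℝ, E) ∞ (fun p : ℝ × M => ψ p.1 p.2) (t, x) :=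
  hψ.smooth.contMDiffAt ((hJ.prod isOpen_univ).mem_nhds ⟨ht, mem_univ _⟩)

lemma contMDiffAt_flow_extChartAt_symm (hJ : IsOpen J) (hψ : IsGeneratedBy J ψ X) (ht : t ∈ J)
    (x : M) :
    ContMDiffAt 𝓘(ℝ, ℝ × E) 𝓘(ℝ, E) ∞
      (fun q : ℝ × E => ψ q.1 ((extChartAt 𝓘(ℝ, E) x).symm q.2)) (t, extChartAt 𝓘(ℝ, E) x x) := by
  have hb : ContMDiffAt 𝓘(ℝ, ℝ × E) (𝓘(ℝ, ℝ).prod 𝓘(ℝ, E)) ∞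
      (fun q : ℝ × E => (q.1, (extChartAt 𝓘(ℝ, E) x).symm q.2)) (t, extChartAt 𝓘(ℝ, E) x x) :=
    contDiff_fst.contMDiff.contMDiffAt.prodMk
      (ContMDiffAt.comp (t, extChartAt 𝓘(ℝ, E) x x)
        (contMDiffAt_extChartAt_symm x (mem_extChartAt_target x))
        contDiff_snd.contMDiff.contMDiffAt)
  refine ContMDiffAt.comp (g := fun p : ℝ × M => ψ p.1 p.2) _ ?_ hb
  rw [extChartAt_to_inv]
  exact hψ.contMDiffAt hJ ht x

lemma contDiffAt_chartFlow (hJ : IsOpen J) (hψ : IsGeneratedBy J ψ X) (ht : t ∈ J) (x : M) :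
    ContDiffAt ℝ ∞ (chartFlow ψ t x) (t, extChartAt 𝓘(ℝ, E) x x) := by
  refine ContMDiffAt.contDiffAt (ContMDiffAt.comp (g := extChartAt 𝓘(ℝ, E) (ψ t x)) _ ?_
    (contMDiffAt_flow_extChartAt_symm hJ hψ ht x))
  simp only [extChartAt_to_inv]
  exact contMDiffAt_extChartAt

lemma eventually_flow_mem_source (hJ : IsOpen J) (hψ : IsGeneratedBy J ψ X) (ht : t ∈ J)
    (x : M) :
    ∀ᶠ q in 𝓝 (t, extChartAt 𝓘(ℝ, E) x x), ψ q.1 ((extChartAt 𝓘(ℝ, E) x).symm q.2) ∈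
      (extChartAt 𝓘(ℝ, E) (ψ t x)).source := by
  refine (contMDiffAt_flow_extChartAt_symm hJ hψ ht x).continuousAt.eventually_mem ?_
  simp only [extChartAt_to_inv]
  exact extChartAt_source_mem_nhds (ψ t x)

lemma fderiv_chartFlow_time (hJ : IsOpen J) (hψ : IsGeneratedBy J ψ X) (ht : t ∈ J)
    (x : M) :
    ∀ᶠ y in 𝓝 (extChartAt 𝓘(ℝ, E) x x), fderiv ℝ (chartFlow ψ t x) (t, y) (1, 0) =
      chartField (ψ t x) (X t) (chartFlow ψ t x (t, y)) := by
  have hcont : ContinuousAt (fun y : E => (t, y)) (extChartAt 𝓘(ℝ, E) x x) := by fun_prop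
  have h1 := hcont.eventually (eventually_flow_mem_source hJ hψ ht x)
  -- The order is lowered to `1` because being `C^n` at a point passes to nearby points for finite
  -- `n`, while for order `∞` the neighbourhood may depend on the order.
  have h2 := hcont.eventually (((contDiffAt_chartFlow hJ hψ ht x).of_le
    (m := 1) (by simp)).eventually (by simp))
  filter_upwards [h1, h2] with y hy hdiff
  have hv := hψ.velocity t ht ((extChartAt 𝓘(ℝ, E) x).symm y)
  have he := (mdifferentiableAt_extChartAt (I := 𝓘(ℝ, E)) (x := ψ t x)
    (by simpa using hy)).hasMFDerivAt
  have hc := HasMFDerivAt.comp t he hv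
  have hd : HasDerivAt (fun s => chartFlow ψ t x (s, y))
      (fderiv ℝ (chartFlow ψ t x) (t, y) (1, 0)) t :=
    hasDerivAt_comp_prodMk (hdiff.differentiableAt (by simp)) (hasDerivAt_const t y)
  have h3 := congrArg (fun A : ℝ →L[ℝ] E => A 1) (hd.hasFDerivAt.unique hc.hasFDerivAt)
  have h4 := chartField_extChartAt (ψ t x) hy (X t)
  refine Eq.trans ?_ h4.symm
  refine Eq.trans (one_smul ℝ _).symm (h3.trans ?_)
  exact congrArg (mfderiv 𝓘(ℝ, E) 𝓘(ℝ, E) (extChartAt 𝓘(ℝ, E) (ψ t x))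
    (ψ t ((extChartAt 𝓘(ℝ, E) x).symm y))) (one_smul ℝ (X t _))

/-- The target chart stays the one at `ψ t x` while `s` varies, so that the pulled-back metrics at
all nearby times are expressed in one chart. -/
lemma eventually_mfderiv_flow (hJ : IsOpen J) (hψ : IsGeneratedBy J ψ X) (ht : t ∈ J)
    (x : M) :
    ∀ᶠ s in 𝓝 t, ψ s x ∈ (extChartAt 𝓘(ℝ, E) (ψ t x)).source ∧
      ∀ u : TangentSpace 𝓘(ℝ, E) x, mfderiv 𝓘(ℝ, E) 𝓘(ℝ, E) (ψ s) x u =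
        dchart E (ψ t x) (extChartAt 𝓘(ℝ, E) (ψ t x) (ψ s x))
          (fderiv ℝ (chartFlow ψ t x) (s, extChartAt 𝓘(ℝ, E) x x)
            (0, mfderiv 𝓘(ℝ, E) 𝓘(ℝ, E) (extChartAt 𝓘(ℝ, E) x) x u)) := by
  have hcont : ContinuousAt (fun s : ℝ => (s, extChartAt 𝓘(ℝ, E) x x)) t := by fun_prop
  have h1 := hcont.eventually (eventually_flow_mem_source hJ hψ ht x)
  have h2 := hcont.eventually (((contDiffAt_chartFlow hJ hψ ht x).of_le
    (m := 1) (by simp)).eventually (by simp))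
  filter_upwards [h1, h2] with s hs hdiff
  simp only [extChartAt_to_inv] at hs
  refine ⟨hs, fun u => ?_⟩
  have he := (mdifferentiableAt_extChartAt (I := 𝓘(ℝ, E)) (x := ψ t x)
    (by simpa using hs)).hasMFDerivAt
  have hs' := ((ψ s).contMDiff.mdifferentiableAt (x := x) (by simp)).hasMFDerivAt
  have hc := HasMFDerivAt.comp x he hs'
  have hslice : HasFDerivAt (fun y => chartFlow ψ t x (s, y))
      ((fderiv ℝ (chartFlow ψ t x) (s, extChartAt 𝓘(ℝ, E) x x)).comp
        (ContinuousLinearMap.inr ℝ ℝ E)) (extChartAt 𝓘(ℝ, E) x x) :=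
    hasFDerivAt_slice (hdiff.differentiableAt (by simp))
  have hk := (mdifferentiableAt_extChartAt (I := 𝓘(ℝ, E)) (x := x)
    (mem_chart_source E x)).hasMFDerivAt
  have hc' := HasMFDerivAt.comp x hslice.hasMFDerivAt hk
  have heq : (fun y => chartFlow ψ t x (s, y)) ∘ extChartAt 𝓘(ℝ, E) x =ᶠ[𝓝 x]
      extChartAt 𝓘(ℝ, E) (ψ t x) ∘ ψ s := by
    filter_upwards [extChartAt_source_mem_nhds (I := 𝓘(ℝ, E)) x] with z hz
    simp only [Function.comp, chartFlow]
    rw [(extChartAt 𝓘(ℝ, E) x).left_inv hz]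
  have h3 := congrArg (fun A : E →L[ℝ] E => A u)
    (hasMFDerivAt_unique hc (hc'.congr_of_eventuallyEq heq.symm))
  have h4 := dchart_mfderiv_extChartAt (ψ t x) hs (mfderiv 𝓘(ℝ, E) 𝓘(ℝ, E) (ψ s) x u)
  rw [← h4]
  exact congrArg (dchart E (ψ t x) (extChartAt 𝓘(ℝ, E) (ψ t x) (ψ s x))) h3

/-- This is the evolution formula without `σ`: the model computation is carried to `M` through the
charts at `x` and `ψ t x`, and its last three terms are recognised by `chart_lieDeriv`. -/
lemma hasDerivAt_pullTwo (hJ : IsOpen J) (hψ : IsGeneratedBy J ψ X) (ht : t ∈ J) (x : M)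
    (hX : IsSmoothField (X t)) {g : ℝ → RMetric E M} (hg : IsSmoothMetricFamily J g)
    (u v : TangentSpace 𝓘(ℝ, E) x) :
    HasDerivAt (fun s => pullTwo (ψ s) (g s).toCovTwo x u v)
      (pullTwo (ψ t) (timeDeriv (fun s => (g s).toCovTwo) t) x u v
        + pullTwo (ψ t) (lieDeriv (X t) (g t).toCovTwo) x u v) t := by
  have := FiniteDimensional.complete ℝ E
  have hflow := eventually_mfderiv_flow hJ hψ ht x
  obtain ⟨hsrc, hdt⟩ := hflow.self_of_nhds
  have hz := mem_extChartAt_target (I := 𝓘(ℝ, E)) (ψ t x)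
  have hF0 : chartFlow ψ t x (t, extChartAt 𝓘(ℝ, E) x x) =
      extChartAt 𝓘(ℝ, E) (ψ t x) (ψ t x) := by
    simp only [chartFlow, extChartAt_to_inv]
  have h := hasDerivAt_pullback_model (F := chartFlow ψ t x)
    (Q := fun q => chartMetric (ψ t x) (g q.1) q.2) (X := chartField (ψ t x) (X t))
    (contDiffAt_chartFlow hJ hψ ht x)
    (by
      rw [hF0]
      exact (contDiffAt_chartMetric_family hJ hg ht (ψ t x) hz).differentiableAt (by simp))
    (by
      rw [hF0]
      exact (contDiffAt_chartField (ψ t x) hz hX.contMDiffAt).differentiableAt (by simp))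
    (fderiv_chartFlow_time hJ hψ ht x)
    (u := mfderiv 𝓘(ℝ, E) 𝓘(ℝ, E) (extChartAt 𝓘(ℝ, E) x) x u)
    (v := mfderiv 𝓘(ℝ, E) 𝓘(ℝ, E) (extChartAt 𝓘(ℝ, E) x) x v) rfl rfl
  rw [hF0] at h
  have hmetric (s : ℝ) (q : M) (hq : q ∈ (extChartAt 𝓘(ℝ, E) (ψ t x)).source) (a b : E) :
      chartMetric (ψ t x) (g s) (extChartAt 𝓘(ℝ, E) (ψ t x) q) a b =
        (g s).toCovTwo q (dchart E (ψ t x) (extChartAt 𝓘(ℝ, E) (ψ t x) q) a)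
          (dchart E (ψ t x) (extChartAt 𝓘(ℝ, E) (ψ t x) q) b) :=
    apply_extChartAt_symm (g s).toCovTwo (ψ t x) hq _ _
  refine (h.congr_of_eventuallyEq ?_).congr_deriv ?_
  · filter_upwards [hflow] with s hs
    obtain ⟨hs1, hs2⟩ := hs
    have hFs : chartFlow ψ t x (s, extChartAt 𝓘(ℝ, E) x x) =
        extChartAt 𝓘(ℝ, E) (ψ t x) (ψ s x) := by
      simp only [chartFlow, extChartAt_to_inv]
    rw [hFs, hmetric s _ hs1, pullTwo, hs2 u, hs2 v]
  · congr 1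
    · simp only [pullTwo, timeDeriv]
      rw [hdt u, hdt v]
      congr 1
      funext s
      exact hmetric s _ hsrc _ _
    · rw [← chart_lieDeriv (ψ t x) (g t) hz hX, pullTwo, hdt u, hdt v]
      exact apply_extChartAt_symm _ (ψ t x) hsrc _ _

end Flow

/-- This guarantees that `timeDeriv`, built on `deriv`, is a true derivative and not the default
value `0`. -/
lemma differentiableAt_toCovTwo {g : ℝ → RMetric E M} {J : Set ℝ} (hJ : IsOpen J)
    (hg : IsSmoothMetricFamily J g) {t : ℝ} (ht : t ∈ J) (x : M)
    (u v : TangentSpace 𝓘(ℝ, E) x) :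
    DifferentiableAt ℝ (fun s => (g s).toCovTwo x u v) t := by
  have hA := (hg.contMDiffAt ((hJ.prod isOpen_univ).mem_nhds ⟨ht, mem_univ x⟩)).comp t
    (contMDiffAt_id.prodMk (contMDiffAt_const (c := x)))
  have h := contMDiffAt_inner (u := fun _ : ℝ => u) (v := fun _ : ℝ => v) hA contMDiffAt_const
    contMDiffAt_const
  exact h.contDiffAt.differentiableAt (by simp)


end

section

variable {E : Type*} [NormedAddCommGroup E] [NormedSpace ℝ E] [FiniteDimensional ℝ E]
  {M : Type*} [TopologicalSpace M] [T2Space M] [ChartedSpace E M] [IsManifold 𝓘(ℝ, E) ∞ M]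

/-! ### The flow of a soliton -/

/-- The pullback of an almost contact metric structure by a diffeomorphism, with the metric scaled
by `c > 0`. -/
lemma IsAlmostContactMetric.scaledPullback {G : RMetric E M} {φ : EndField E M} {ξ : VField E M}
    {η : OneForm E M} (h : IsAlmostContactMetric G.toCovTwo φ ξ η)
    (ψ : M ≃ₘ⟮𝓘(ℝ, E), 𝓘(ℝ, E)⟯ M) {c : ℝ} (hc : 0 < c) :
    IsAlmostContactMetric (pullMetric ψ G hc).toCovTwo (pullEnd ψ φ) ((√c)⁻¹ • pullField ψ ξ)
      (√c • pullForm ψ η) := by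
  have hs : √c ≠ 0 := (Real.sqrt_pos.2 hc).ne'
  have hφ (x : M) (w : TangentSpace 𝓘(ℝ, E) x) :
      dequiv ψ x (pullEnd ψ φ x w) = φ (ψ x) (dequiv ψ x w) :=
    (isInvertible_mfderiv ψ x).self_apply_inverse _
  have hξ (x : M) : dequiv ψ x (pullField ψ ξ x) = ξ (ψ x) := mfderiv_pullField ψ ξ x
  have hη (x : M) (w : TangentSpace 𝓘(ℝ, E) x) :
      (√c • pullForm ψ η) x w = √c * η (ψ x) (dequiv ψ x w) := rfl
  have hg (x : M) (u v : TangentSpace 𝓘(ℝ, E) x) : (pullMetric ψ G hc).toCovTwo x u v =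
      c * G.toCovTwo (ψ x) (dequiv ψ x u) (dequiv ψ x v) := rfl
  -- The factors `√c` and `(√c)⁻¹` cancel in `η(ξ)` and `η ⊗ ξ`, while `η ⊗ η` acquires `√c * √c =
  -- c`, the scale of the metric.
  refine ⟨⟨_, rfl⟩, contMDiff_pullEnd h.smooth_phi, (h.smooth_xi.pullField ψ).const_smul _,
    contMDiff_smul_pullForm _ h.smooth_eta, fun x u => ?_, fun x => ?_, fun x u v => ?_⟩
  · refine (dequiv ψ x).injective ?_
    rw [hφ, hφ, h.phi_phi, hη, map_add, map_neg, map_smul]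
    have : ((√c)⁻¹ • pullField ψ ξ) x = (√c)⁻¹ • pullField ψ ξ x := rfl
    rw [this, map_smul, hξ, smul_smul, mul_right_comm, mul_inv_cancel₀ hs, one_mul]
  · have : ((√c)⁻¹ • pullField ψ ξ) x = (√c)⁻¹ • pullField ψ ξ x := rfl
    rw [hη, this, map_smul, hξ, map_smul, h.eta_xi, smul_eq_mul, mul_one, mul_inv_cancel₀ hs]
  · rw [hg, hg, hη, hη, hφ, hφ, h.compat]
    linear_combination (η (ψ x) (dequiv ψ x u) * η (ψ x) (dequiv ψ x v)) * Real.mul_self_sqrt hc.le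

/-- The product rule gives `-2λ ψ^*g + σ ψ^* L_{Y/σ} g = ψ^*(L_Y g - 2λ g)`, and the soliton
equation is applied at `ψ t x`. -/
lemma IsStarRicciSoliton.hasDerivAt {G : RMetric E M} {φ : EndField E M} {Y : VField E M}
    {lam : ℝ} (hY : IsSmoothField Y) (hsol : IsStarRicciSoliton G.toCovTwo φ Y lam) {σ : ℝ → ℝ}
    (hσ : ∀ t, σ t = 1 - 2 * lam * t) {J : Set ℝ} (hJ : IsOpen J)
    {ψ : ℝ → (M ≃ₘ⟮𝓘(ℝ, E), 𝓘(ℝ, E)⟯ M)} (hψ : IsGeneratedBy J ψ (fun t => (σ t)⁻¹ • Y))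
    {t : ℝ} (ht : t ∈ J) (hpos : 0 < σ t) (x : M) (u v : TangentSpace 𝓘(ℝ, E) x) :
    HasDerivAt (fun s => σ s * pullTwo (ψ s) G.toCovTwo x u v)
      (-2 * pullTwo (ψ t) (starRicci G.toCovTwo φ) x u v) t := by
  have h1 := hasDerivAt_pullTwo hJ hψ ht x (hY.const_smul _) (isSmoothMetricFamily_const J G) u v
  have h2 : HasDerivAt σ (-(2 * lam)) t := by
    have : σ = fun t => 1 - 2 * lam * t := funext hσ
    rw [this]
    simpa using ((hasDerivAt_id t).const_mul (2 * lam)).const_sub 1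
  refine (h2.mul h1).congr_deriv ?_
  have h3 := hsol (ψ t x) (mfderiv 𝓘(ℝ, E) 𝓘(ℝ, E) (ψ t) x u) (mfderiv 𝓘(ℝ, E) 𝓘(ℝ, E) (ψ t) x v)
  simp only [pullTwo, timeDeriv, deriv_const, zero_add]
  rw [lieDeriv_const_smul G hY, h3, mul_inv_cancel_left₀ hpos.ne']
  ring

end

end StarRicci

end

/-! ### Assembly of the two statements -/

theorem proposition1p1
    {E : Type*} [NormedAddCommGroup E] [NormedSpace ℝ E] [FiniteDimensional ℝ E]
    {M : Type*} [TopologicalSpace M] [T2Space M] [SecondCountableTopology M]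
    [ChartedSpace E M] [IsManifold 𝓘(ℝ, E) ∞ M] :
    -- evolution of `σ(t) ψ_t^* g(t)` for a general family of metrics
    (∀ (J : Set ℝ), IsOpen J →
      ∀ (g : ℝ → StarRicci.RMetric E M), StarRicci.IsSmoothMetricFamily J g →
      ∀ (X : ℝ → StarRicci.VField E M), (∀ t ∈ J, StarRicci.IsSmoothField (X t)) →
      ∀ (ψ : ℝ → (M ≃ₘ⟮𝓘(ℝ, E), 𝓘(ℝ, E)⟯ M)), StarRicci.IsGeneratedBy J ψ X →
      ∀ (σ : ℝ → ℝ), DifferentiableOn ℝ σ J →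
      ∀ t ∈ J, ∀ (x : M) (u v : TangentSpace 𝓘(ℝ, E) x),
        (∀ (y : M) (w z : TangentSpace 𝓘(ℝ, E) y),
          DifferentiableAt ℝ (fun s => (g s).toCovTwo y w z) t) ∧
        HasDerivAt (fun s => σ s * StarRicci.pullTwo (ψ s) (g s).toCovTwo x u v)
          (deriv σ t * StarRicci.pullTwo (ψ t) (g t).toCovTwo x u v
            + σ t * StarRicci.pullTwo (ψ t)
                (StarRicci.timeDeriv (fun s => (g s).toCovTwo) t) x u v
            + σ t * StarRicci.pullTwo (ψ t)
                (StarRicci.lieDeriv (X t) (g t).toCovTwo) x u v) t) ∧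
    -- a `*`-Ricci soliton evolves self-similarly under the `*`-Ricci flow
    (∀ (g₀ : StarRicci.CovTwo E M) (φ : StarRicci.EndField E M) (ξ : StarRicci.VField E M)
      (η : StarRicci.OneForm E M), StarRicci.IsAlmostContactMetric g₀ φ ξ η →
      ∀ (Y : StarRicci.VField E M) (lam : ℝ), StarRicci.IsSmoothField Y →
      StarRicci.IsStarRicciSoliton g₀ φ Y lam →
      ∀ (σ : ℝ → ℝ), (∀ t, σ t = 1 - 2 * lam * t) →
      ∀ (J : Set ℝ), IsOpen J → J.OrdConnected → (0 : ℝ) ∈ J → (∀ t ∈ J, 0 < σ t) →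
      ∀ (ψ : ℝ → (M ≃ₘ⟮𝓘(ℝ, E), 𝓘(ℝ, E)⟯ M)),
      StarRicci.IsGeneratedBy J ψ (fun t => (σ t)⁻¹ • Y) → (∀ x, ψ 0 x = x) →
      ∀ (gbar : ℝ → StarRicci.CovTwo E M),
      (∀ t x u v, gbar t x u v = σ t * StarRicci.pullTwo (ψ t) g₀ x u v) →
        gbar 0 = g₀ ∧
        StarRicci.IsStarRicciFlow J gbar
          (fun t => StarRicci.pullEnd (ψ t) φ)
          (fun t => (√(σ t))⁻¹ • StarRicci.pullField (ψ t) ξ)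
          (fun t => √(σ t) • StarRicci.pullForm (ψ t) η) ∧
        -- if every `ψ_t` preserves `φ`, the structure tensor is constant along the flow
        ((∀ t ∈ J, StarRicci.pullEnd (ψ t) φ = φ) →
          StarRicci.StarRicciFlowEq J gbar (fun _ => φ))) := by
  refine ⟨?_, ?_⟩
  · intro J hJ g hg X hX ψ hψ σ hσ t ht x u v
    refine ⟨fun y w z => StarRicci.differentiableAt_toCovTwo hJ hg ht y w z, ?_⟩
    have h1 := StarRicci.hasDerivAt_pullTwo hJ hψ ht x (hX t ht) hg u v
    have h2 := ((hσ t ht).differentiableAt (hJ.mem_nhds ht)).hasDerivAt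
    refine (h2.mul h1).congr_deriv ?_
    ring
  · intro g₀ φ ξ η hacm Y lam hY hsol σ hσ J hJ _ h0 hpos ψ hψ hψ0 gbar hgbar
    obtain ⟨G, rfl⟩ := hacm.riemannian
    -- Only for `t ∈ J` is `σ t` known to be positive, so only there is `gbar t` presented as a
    -- Riemannian metric.
    have hmetric (t : ℝ) (ht : t ∈ J) :
        gbar t = (StarRicci.pullMetric (ψ t) G (hpos t ht)).toCovTwo := by
      funext x u v
      exact hgbar t x u v
    have hflow : StarRicci.StarRicciFlowEq J gbar (fun t => StarRicci.pullEnd (ψ t) φ) := by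
      intro t ht x u v
      rw [hmetric t ht, StarRicci.starRicci_pullMetric]
      -- The differentiated function involves all times `s`, including those outside `J`, so the
      -- pointwise formula replaces `hmetric` here.
      simp only [hgbar]
      exact hsol.hasDerivAt hY hσ hJ hψ ht (hpos t ht) x u v
    refine ⟨?_, ⟨fun t ht => ?_, hflow⟩, fun hpres t ht x u v => ?_⟩
    -- At time `0` the derivative of `ψ` is the identity and `σ 0 = 1`.
    · have hid : (ψ 0 : M → M) = id := funext hψ0
      funext x u v
      rw [hgbar, hσ, StarRicci.pullTwo, hid, mfderiv_id]
      simp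
    · rw [hmetric t ht]
      exact hacm.scaledPullback (ψ t) (hpos t ht)
    · have h := hflow t ht x u v
      simp only [hpres t ht] at h
      exact h
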